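/- There is an absolute constant $C>0$ such that for every finite metric space $M$ with $n$ points there is a deterministic online algorithm for online service with delay on $M$ that is $C\log n$-competitive. Here an input consists of an initial location $x\in M$ of the server and a finite collection of requests. Each request $q$ has a location $p_q\in M$, a release time $r_q\in\mathbb R$ and a delay function $y_q:[r_q,\infty)\to[0,\infty)$ that is continuous and nondecreasing, with $y_q(r_q)=0$ and $y_q(t)\to\infty$ as $t\to\infty$. A schedule is a finite sequence of instantaneous moves of the server, made at nondecreasing times. It serves $q$ at the first time $t\ge r_q$ at which the server is at $p_q$. Its cost is the total distance travelled plus, for every request $q$, the delay cost $y_q(t)$ with $t$ the time at which $q$ is served (and $\infty$ if $q$ is never served). A deterministic online algorithm maps every input to a schedule such that the moves made up to any time $t$ depend only on $x$ and on the requests (with their delay functions) released up to time $t$. It is $c$-competitive if on every input its cost is at most $c\cdot\mathrm{OPT}$, where $\mathrm{OPT}$ is the infimum of the costs of all schedules for that input. -/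

import Mathlib

open scoped ENNReal

namespace OnlineService

/-- A request on the metric space `M`: a location, a release time, and a delay function, defined
for the times `t ≥ release` (its values before `release` play no role), which is `0` at the release
time, nondecreasing, continuous, and tends to infinity. -/
structure Request (M : Type*) where
  loc : M
  release : ℝ
  delay : ℝ → ℝ
  delay_release : delay release = 0
  delay_mono : MonotoneOn delay (Set.Ici release)
  delay_cont : ContinuousOn delay (Set.Ici release)
  delay_unbounded : Filter.Tendsto delay Filter.atTop Filter.atTop

/-- A movement plan of the server: a finite list of moves `(t, p)`, meaning that at time `t` the
server moves (instantaneously) to the point `p`. The moves are listed in the order in which they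
are made, so the times are nondecreasing; several moves may be made at the same time. -/
structure Schedule (M : Type*) where
  moves : List (ℝ × M)
  sorted : moves.Pairwise (fun a b => a.1 ≤ b.1)

/-- Total distance travelled by a server that starts at a given point and makes the listed moves. -/
def moveCost {M : Type*} [MetricSpace M] : M → List (ℝ × M) → ℝ
  | _, [] => 0
  | x, m :: l => dist x m.2 + moveCost m.2 l

/-- `IsAt x l p t`: a server that starts at `x` and makes the listed moves is at the point `p` at
time `t`. At the time of one or several moves, the server is at all the points in which it stops at
that time, including those where the first of these moves starts and where the last of them ends. -/
def IsAt {M : Type*} : M → List (ℝ × M) → M → ℝ → Prop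
  | x, [], p, _ => x = p
  | x, m :: l, p, t => (x = p ∧ t ≤ m.1) ∨ (m.1 ≤ t ∧ IsAt m.2 l p t)

/-- The delay cost of a request `q` under a schedule: the value of the delay function at the first
time `t ≥ q.release` at which the server is at the location of `q`. As the delay function is
nondecreasing, this is the infimum over all such times. It is `⊤` if there is no such time, that is,
if the request is never served, because the delay tends to infinity. -/
noncomputable def delayCost {M : Type*} (x : M) (S : Schedule M) (q : Request M) : ℝ≥0∞ :=
  ⨅ t ∈ {t : ℝ | q.release ≤ t ∧ IsAt x S.moves q.loc t}, ENNReal.ofReal (q.delay t)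

/-- Total cost of a schedule on the input with initial server location `x` and requests `I`:
movement cost plus the delay costs of all requests. -/
noncomputable def cost {M : Type*} [MetricSpace M] (x : M) (I : List (Request M))
    (S : Schedule M) : ℝ≥0∞ :=
  ENNReal.ofReal (moveCost x S.moves) + (I.map (delayCost x S)).sum

/-- The optimal offline cost. -/
noncomputable def opt {M : Type*} [MetricSpace M] (x : M) (I : List (Request M)) : ℝ≥0∞ :=
  ⨅ S : Schedule M, cost x I S

/-- A deterministic online algorithm on `M`: it maps an input (an initial server location and a
finite collection of requests) to a schedule, in such a way that the moves made up to any time `t`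
depend only on the initial location and on the requests released up to time `t`. (A request,
including its delay function, becomes known to the algorithm at its release.) -/
structure OnlineAlgorithm (M : Type*) where
  run : M → List (Request M) → Schedule M
  online : ∀ (x : M) (I J : List (Request M)) (t : ℝ),
    I.filter (fun q => q.release ≤ t) = J.filter (fun q => q.release ≤ t) →
      (run x I).moves.filter (fun m => m.1 ≤ t) = (run x J).moves.filter (fun m => m.1 ≤ t)

/-- The algorithm `A` is `c`-competitive: on every input its cost is at most `c` times the
optimal offline cost. -/
def OnlineAlgorithm.IsCompetitive {M : Type*} [MetricSpace M] (A : OnlineAlgorithm M)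
    (c : ℝ) : Prop :=
  ∀ (x : M) (I : List (Request M)), cost x I (A.run x I) ≤ ENNReal.ofReal c * opt x I

end OnlineService

/-!
The algorithm works on levels `ℓ`, of scale `8 ^ ℓ`. Every pending request has a level, at first
`⊥`, and a part of its delay that has been paid for. A service is triggered when, for some `ℓ`, the
requests of level at most `ℓ` within distance `8 ^ ℓ` of the server have unpaid delay `8 ^ ℓ`. It is
made on the largest level `ℓ` with a substantial load. It pays all delay of the requests of level at
most `ℓ` within distance `8 * 8 ^ ℓ`, looks ahead up to the time at which avoiding or paying the
further delay of these requests costs about `18 * 8 ^ ℓ` (`exists_plan`), makes the corresponding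
prize-collecting tour, and raises the requests that it did not serve to level `ℓ + 1`. If the unpaid
delay comes from requests at distance about `8 ^ ℓ` that are of lower level, rather than from
requests of level exactly `ℓ`, and most of it lies close to one point, then the server moves there.
Each service costs `O(8 ^ ℓ)` (`cost_algorithm_le`), so it remains to bound the sum of the scales of
the services by the cost of any schedule.

A service of level `ℓ` triggered by a request of level exactly `ℓ` is charged to its origin, the
service of level `ℓ - 1` that raised this request (`Offline.pow_le_of_isOrigin`). By the choice of
the horizon of the origin, a schedule either pays much of the delay that the origin paid, or visits
by the horizon a set of requests that has no cheap tour. In the other case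
(`Offline.pow_le_of_not_local`) a schedule pays much of the unpaid delay, or has moved far since the
requests were released, or has its server close to most of them; then the server of the algorithm
gets closer to it, which is paid by the decrease of the distance between the two servers
(`Offline.sum_drop_le`).

The delay charges are disjoint pieces of the delay of each request (`Offline.sum_delayShare_le`).
The moves charged by two services of the same kind and level are disjoint, because a service leaves
no request of at most its level in its vicinity (`lt_dist_of_active`). So a move could at worst be
charged once on each level. What limits the number of levels is that a walk in a space with `n`
points can be covered by a tour along at most `n` of its moves (`exists_tour_of_walk`), so a service
of scale `ρ` only needs to charge moves of length at least about `ρ / n`, each truncated at `ρ`. A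
move of length `d` is then charged `O(d)` by the scales below `d` together, and at most `d` by each
of the `O(log n)` scales between `d` and `O(n * d)` (`sum_charges_le`).
-/

namespace OnlineService

/-! ### Geometric sums over levels -/

lemma sum_zpow_le_of_forall_le (F : Finset ℤ) :
    ∀ p : ℤ, (∀ l ∈ F, l ≤ p) → ∑ l ∈ F, (8 : ℝ) ^ l ≤ 2 * 8 ^ p := by
  induction F using Finset.induction_on_max with
  | empty => intro p _; simp only [Finset.sum_empty]; positivity
  | insert a s has ih =>
    intro p hp
    have hna : a ∉ s := fun h => lt_irrefl _ (has a h)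
    rw [Finset.sum_insert hna]
    have h1 := ih (a - 1) fun l hl => by have := has l hl; omega
    have h2 : (8 : ℝ) ^ (a - 1) = 8 ^ a / 8 := by rw [zpow_sub_one₀ (by norm_num)]; ring
    have h3 : (8 : ℝ) ^ a ≤ 8 ^ p :=
      zpow_le_zpow_right₀ (by norm_num) (hp a (Finset.mem_insert_self _ _))
    have h4 : (0 : ℝ) < 8 ^ a := by positivity
    rw [h2] at h1
    linarith

/-- Truncated at the length `d` of a move, the scales up to `X * d` add up to `O(log X) * d`: those
below `d` form a geometric series, and only `O(log X)` of them lie between `d` and `X * d`. -/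
lemma sum_min_zpow_le (F : Finset ℤ) {d X : ℝ} (hd : 0 < d) (hX : 1 ≤ X)
    (hF : ∀ l ∈ F, (8 : ℝ) ^ l ≤ X * d) :
    ∑ l ∈ F, min d ((8 : ℝ) ^ l) ≤ (3 + Real.log X) * d := by
  have hlogX : 0 ≤ Real.log X := Real.log_nonneg hX
  set p := Int.log 8 d with hp
  have hp1 : (8 : ℝ) ^ p ≤ d := by exact_mod_cast Int.zpow_log_le_self (b := 8) (by norm_num) hd
  have hp2 : d < (8 : ℝ) ^ (p + 1) := by
    exact_mod_cast Int.lt_zpow_succ_log_self (b := 8) (by norm_num) d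
  rw [← Finset.sum_filter_add_sum_filter_not F (fun l => l ≤ p)]
  have h1 : ∑ l ∈ F with l ≤ p, min d ((8 : ℝ) ^ l) ≤ 2 * d := by
    calc _ ≤ ∑ l ∈ F with l ≤ p, (8 : ℝ) ^ l := Finset.sum_le_sum fun _ _ => min_le_right _ _
      _ ≤ 2 * 8 ^ p := sum_zpow_le_of_forall_le _ p fun l hl => (Finset.mem_filter.1 hl).2
      _ ≤ 2 * d := by linarith
  have hcard : ((F.filter fun l => ¬ l ≤ p).card : ℝ) ≤ Real.log X + 1 := by
    have hsub : (F.filter fun l => ¬ l ≤ p) ⊆ Finset.Icc (p + 1) (p + 1 + ⌊Real.log X⌋) := by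
      intro l hl
      obtain ⟨hlF, hlp⟩ := Finset.mem_filter.1 hl
      rw [Finset.mem_Icc]
      refine ⟨by omega, ?_⟩
      have h := hF l hlF
      have h' : (8 : ℝ) ^ (l - (p + 1)) ≤ X := by
        rw [zpow_sub₀ (by norm_num), div_le_iff₀ (by positivity)]
        exact h.trans (by gcongr)
      have h'' := Real.log_le_log (by positivity) h'
      rw [Real.log_zpow] at h''
      have hlog8 : 1 ≤ Real.log 8 := by
        rw [Real.le_log_iff_exp_le (by norm_num)]
        linarith [Real.exp_one_lt_d9]
      have hnn : (0 : ℝ) ≤ ((l - (p + 1) : ℤ) : ℝ) := by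
        exact_mod_cast (by omega : (0 : ℤ) ≤ l - (p + 1))
      have : ((l - (p + 1) : ℤ) : ℝ) ≤ Real.log X := by nlinarith
      have := Int.le_floor.2 this
      omega
    have hc := Finset.card_le_card hsub
    rw [Int.card_Icc] at hc
    have hfl : 0 ≤ ⌊Real.log X⌋ := Int.floor_nonneg.2 hlogX
    have hc' : ((F.filter fun l => ¬ l ≤ p).card : ℤ) ≤ ⌊Real.log X⌋ + 1 := by omega
    have : ((F.filter fun l => ¬ l ≤ p).card : ℝ) ≤ (⌊Real.log X⌋ : ℝ) + 1 := by exact_mod_cast hc'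
    linarith [Int.floor_le (Real.log X)]
  have h2 : ∑ l ∈ F with ¬ l ≤ p, min d ((8 : ℝ) ^ l) ≤ (Real.log X + 1) * d := by
    calc _ ≤ ∑ l ∈ F with ¬ l ≤ p, d := Finset.sum_le_sum fun _ _ => min_le_left _ _
      _ = _ := by rw [Finset.sum_const, nsmul_eq_mul]
      _ ≤ _ := by gcongr
  linarith

/-- If each `c ∈ T` of level `lev c` charges a set `C c` of moves that are not much shorter than its
scale, and no move is charged twice on the same level, then the charges add up to a logarithmic
multiple of the total length of the moves. -/
lemma sum_charges_le (T : Finset ℕ) (lev : ℕ → ℤ) (C : ℕ → Finset ℕ) (m : ℕ) (d : ℕ → ℝ) {X : ℝ}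
    (hX : 1 ≤ X) (hC : ∀ c ∈ T, ∀ j ∈ C c, j < m ∧ (8 : ℝ) ^ lev c ≤ X * d j)
    (hdis : ∀ c ∈ T, ∀ c' ∈ T, ∀ j ∈ C c, j ∈ C c' → lev c = lev c' → c = c') :
    ∑ c ∈ T, ∑ j ∈ C c, min (d j) ((8 : ℝ) ^ lev c) ≤
      (3 + Real.log X) * ∑ j ∈ Finset.range m with 0 < d j, d j := by
  have hpos : ∀ c ∈ T, ∀ j ∈ C c, 0 < d j := fun c hc j hj => by
    have h1 := (hC c hc j hj).2
    have h2 : (0 : ℝ) < 8 ^ lev c := by positivity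
    exact pos_of_mul_pos_right (h2.trans_le h1) (by linarith)
  rw [Finset.sum_comm' (t' := (Finset.range m).filter fun j => 0 < d j)
    (s' := fun j => T.filter fun c => j ∈ C c), Finset.mul_sum]
  · refine Finset.sum_le_sum fun j hj => ?_
    have hinj : Set.InjOn lev (T.filter fun c => j ∈ C c) := by
      intro c hc c' hc' h
      simp only [Finset.coe_filter, Set.mem_ofPred_eq] at hc hc'
      exact hdis c hc.1 c' hc'.1 j hc.2 hc'.2 h
    rw [← Finset.sum_image (f := fun l : ℤ => min (d j) ((8 : ℝ) ^ l)) hinj]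
    refine sum_min_zpow_le _ (Finset.mem_filter.1 hj).2 hX fun l hl => ?_
    obtain ⟨c, hc, rfl⟩ := Finset.mem_image.1 hl
    exact (hC c (Finset.mem_filter.1 hc).1 j (Finset.mem_filter.1 hc).2).2
  · intro c j
    simp only [Finset.mem_filter, Finset.mem_range]
    constructor
    · rintro ⟨hc, hj⟩
      exact ⟨⟨hc, hj⟩, (hC c hc j hj).1, hpos c hc j hj⟩
    · rintro ⟨⟨hc, hj⟩, -⟩
      exact ⟨hc, hj⟩

/-! ### Walks and tours -/

variable {M : Type*}

open Classical in
/-- The moves of the walk `u`, started at index `k₀`, up to index `k`, that lead to a point that has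
not been visited before. -/
noncomputable def firstVisits (u : ℕ → M) (k₀ k : ℕ) : Finset ℕ :=
  (Finset.Ico k₀ k).filter fun j => ∀ i, k₀ ≤ i → i ≤ j → u i ≠ u (j + 1)

lemma card_firstVisits_le [Fintype M] (u : ℕ → M) (k₀ k : ℕ) :
    (firstVisits u k₀ k).card ≤ Fintype.card M := by
  classical
  refine Finset.card_le_card_of_injOn (t := Finset.univ) (fun j => u (j + 1))
    (fun _ _ => Finset.mem_coe.2 (Finset.mem_univ _)) ?_
  have key : ∀ i ∈ firstVisits u k₀ k, ∀ j ∈ firstVisits u k₀ k, i < j → u (i + 1) ≠ u (j + 1) := by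
    intro i hi j hj hij
    simp only [firstVisits, Finset.mem_filter, Finset.mem_Ico] at hi hj
    exact hj.2 (i + 1) (by omega) hij
  intro i hi j hj h
  by_contra hne
  rcases lt_or_gt_of_ne hne with h' | h'
  · exact key i hi j hj h' h
  · exact key j hj i hi h' h.symm

lemma firstVisits_succ (u : ℕ → M) {k₀ k : ℕ} (hk : k₀ ≤ k)
    (h : ∀ i, k₀ ≤ i → i ≤ k → u i ≠ u (k + 1)) :
    firstVisits u k₀ (k + 1) = insert k (firstVisits u k₀ k) := by
  ext j
  simp only [firstVisits, Finset.mem_insert, Finset.mem_filter, Finset.mem_Ico]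
  constructor
  · rintro ⟨h1, h2⟩
    rcases eq_or_ne j k with rfl | hne
    · exact Or.inl rfl
    · exact Or.inr ⟨by omega, h2⟩
  · rintro (rfl | ⟨h1, h2⟩)
    · exact ⟨by omega, h⟩
    · exact ⟨by omega, h2⟩

lemma firstVisits_succ_subset (u : ℕ → M) (k₀ k : ℕ) :
    firstVisits u k₀ k ⊆ firstVisits u k₀ (k + 1) := by
  intro j
  simp only [firstVisits, Finset.mem_filter, Finset.mem_Ico]
  rintro ⟨h1, h2⟩
  exact ⟨by omega, h2⟩

variable [MetricSpace M]

/-- The length of the path that starts at a given point and visits the listed points in turn. -/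
def pathLen : M → List M → ℝ
  | _, [] => 0
  | x, p :: l => dist x p + pathLen p l

/-- The length of the closed tour that starts at `a`, visits the listed points in turn, and returns
to `a`. -/
def tourLen (a : M) (l : List M) : ℝ := pathLen a (l ++ [a])

lemma pathLen_nonneg (x : M) (l : List M) : 0 ≤ pathLen x l := by
  induction l generalizing x with
  | nil => exact le_rfl
  | cons p l ih => exact add_nonneg dist_nonneg (ih p)

lemma tourLen_nonneg (x : M) (l : List M) : 0 ≤ tourLen x l := pathLen_nonneg _ _

lemma tourLen_cons_le (a p : M) (l : List M) : tourLen a (p :: l) ≤ tourLen a l + 2 * dist a p := by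
  unfold tourLen
  cases l with
  | nil => simp [pathLen, dist_comm p a]; linarith
  | cons y l =>
    simp only [List.cons_append, pathLen]
    linarith [dist_triangle_left p y a]

lemma exists_insert_pathLen_le (p p' : M) (x : M) (l e : List M) (h : p ∈ x :: l) :
    ∃ l' : List M, l ⊆ l' ∧ p' ∈ l' ∧
      pathLen x (l' ++ e) ≤ pathLen x (l ++ e) + 2 * dist p p' := by
  induction l generalizing x with
  | nil =>
    obtain rfl : p = x := by simpa using h
    refine ⟨[p', p], by simp, by simp, ?_⟩
    simp only [List.cons_append, List.nil_append, pathLen, dist_comm p' p]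
    linarith
  | cons y l ih =>
    rcases List.mem_cons.1 h with rfl | h
    · refine ⟨p' :: p :: y :: l, fun a ha => by simp at ha ⊢; tauto, by simp, ?_⟩
      simp only [List.cons_append, pathLen, dist_comm p' p]
      linarith
    · obtain ⟨l', h1, h2, h3⟩ := ih y h
      refine ⟨y :: l', List.cons_subset_cons y h1, List.mem_cons_of_mem _ h2, ?_⟩
      simp only [List.cons_append, pathLen]
      linarith

/-- A detour from a point of a closed tour to a further point. -/
lemma exists_insert_tourLen_le (a p p' : M) (l : List M) (h : p ∈ l) :
    ∃ l' : List M, l ⊆ l' ∧ p' ∈ l' ∧ tourLen a l' ≤ tourLen a l + 2 * dist p p' :=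
  exists_insert_pathLen_le p p' a l [a] (List.mem_cons_of_mem _ h)

/-- A walk can be covered by a closed tour along the moves that discover new points, each of them
traversed twice. -/
lemma exists_tour_of_walk (z : M) (u : ℕ → M) (k₀ k : ℕ) (hk : k₀ ≤ k) :
    (∀ i, k₀ ≤ i → i ≤ k →
      dist (u k₀) (u i) ≤ ∑ j ∈ firstVisits u k₀ k, dist (u j) (u (j + 1))) ∧
    ∃ l : List M, (∀ i, k₀ ≤ i → i ≤ k → u i ∈ l) ∧
      tourLen z l ≤ 2 * dist z (u k₀) +
        2 * ∑ j ∈ firstVisits u k₀ k, dist (u j) (u (j + 1)) := by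
  induction k, hk using Nat.le_induction with
  | base =>
    refine ⟨fun i h1 h2 => ?_, [u k₀], fun i h1 h2 => ?_, ?_⟩
    · obtain rfl : i = k₀ := by omega
      rw [dist_self]
      exact Finset.sum_nonneg fun _ _ => dist_nonneg
    · obtain rfl : i = k₀ := by omega
      simp
    · have : 0 ≤ ∑ j ∈ firstVisits u k₀ k₀, dist (u j) (u (j + 1)) :=
        Finset.sum_nonneg fun _ _ => dist_nonneg
      simp only [tourLen, List.cons_append, List.nil_append, pathLen, dist_comm (u k₀) z]
      linarith
  | succ k hk ih =>
    obtain ⟨ih1, l, hl, hlen⟩ := ih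
    have hmono : ∑ j ∈ firstVisits u k₀ k, dist (u j) (u (j + 1)) ≤
        ∑ j ∈ firstVisits u k₀ (k + 1), dist (u j) (u (j + 1)) :=
      Finset.sum_le_sum_of_subset_of_nonneg (firstVisits_succ_subset u k₀ k)
        fun _ _ _ => dist_nonneg
    by_cases hnew : ∀ i, k₀ ≤ i → i ≤ k → u i ≠ u (k + 1)
    · have hnot : k ∉ firstVisits u k₀ k := by simp [firstVisits]
      have hsum : ∑ j ∈ firstVisits u k₀ (k + 1), dist (u j) (u (j + 1)) =
          dist (u k) (u (k + 1)) + ∑ j ∈ firstVisits u k₀ k, dist (u j) (u (j + 1)) := by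
        rw [firstVisits_succ u hk hnew, Finset.sum_insert hnot]
      obtain ⟨l', hl', hmem, hlen'⟩ :=
        exists_insert_tourLen_le z (u k) (u (k + 1)) l (hl k hk le_rfl)
      refine ⟨fun i h1 h2 => ?_, l', fun i h1 h2 => ?_, by rw [hsum]; linarith⟩
      · rcases Nat.le_succ_iff.1 h2 with h2 | rfl
        · exact (ih1 i h1 h2).trans hmono
        · rw [hsum]
          linarith [dist_triangle (u k₀) (u k) (u (k + 1)), ih1 k hk le_rfl]
      · rcases Nat.le_succ_iff.1 h2 with h2 | rfl
        · exact hl' (hl i h1 h2)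
        · exact hmem
    · push Not at hnew
      obtain ⟨i₀, h1, h2, h3⟩ := hnew
      refine ⟨fun i hi1 hi2 => ?_, l, fun i hi1 hi2 => ?_, by linarith⟩
      · rcases Nat.le_succ_iff.1 hi2 with hi2 | rfl
        · exact (ih1 i hi1 hi2).trans hmono
        · rw [← h3]; exact (ih1 i₀ h1 h2).trans hmono
      · rcases Nat.le_succ_iff.1 hi2 with hi2 | rfl
        · exact hl i hi1 hi2
        · rw [← h3]; exact hl i₀ h1 h2

/-- Let `C` contain all moves of a walk that start near `z` and are not much shorter than `ρ / n`,
where `n` is the number of points. If the moves in `C`, truncated at `ρ`, are short in total, then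
the whole walk stays near its start, and a short tour covers it: at most `n` of its moves discover
new points, so those outside `C` are negligible. -/
lemma exists_tour_of_charge_lt [Fintype M] (z : M) (u : ℕ → M) {k₀ k₁ : ℕ} (hk : k₀ ≤ k₁)
    {ρ R : ℝ} (hρ : 0 < ρ) (hR : dist z (u k₀) ≤ R * ρ) (C : Finset ℕ)
    (hC : ∀ j, k₀ ≤ j → j < k₁ → dist z (u j) ≤ (R + 1) * ρ →
      ρ ≤ 96 * Fintype.card M * dist (u j) (u (j + 1)) → j ∈ C)
    (hlt : ∑ j ∈ C, min (dist (u j) (u (j + 1))) ρ < ρ / 96) :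
    (∀ i, k₀ ≤ i → i ≤ k₁ → dist (u k₀) (u i) ≤ ρ / 48) ∧
    ∃ l : List M, (∀ i, k₀ ≤ i → i ≤ k₁ → u i ∈ l) ∧
      tourLen z l ≤ 2 * dist z (u k₀) + ρ / 24 := by
  classical
  have hn : 0 < (Fintype.card M : ℝ) := by
    exact_mod_cast Fintype.card_pos_iff.2 ⟨z⟩
  have hmin : ∀ j ∈ C, dist (u j) (u (j + 1)) = min (dist (u j) (u (j + 1))) ρ := by
    intro j hj
    rw [eq_comm, min_eq_left_iff]
    by_contra! hcon
    have : min (dist (u j) (u (j + 1))) ρ ≤ ∑ j ∈ C, min (dist (u j) (u (j + 1))) ρ :=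
      Finset.single_le_sum (f := fun j => min (dist (u j) (u (j + 1))) ρ)
        (fun i _ => le_min dist_nonneg hρ.le) hj
    rw [min_eq_right hcon.le] at this
    linarith
  have key : ∀ k, k₀ ≤ k → k ≤ k₁ →
      ∑ j ∈ firstVisits u k₀ k, dist (u j) (u (j + 1)) ≤ ρ / 48 := by
    intro k
    induction k using Nat.strong_induction_on with
    | _ k ih =>
      intro h0 h1
      rw [← Finset.sum_filter_add_sum_filter_not _ (fun j => j ∈ C)]
      have hA : ∑ j ∈ firstVisits u k₀ k with j ∈ C, dist (u j) (u (j + 1)) ≤ ρ / 96 := by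
        calc _ = ∑ j ∈ firstVisits u k₀ k with j ∈ C, min (dist (u j) (u (j + 1))) ρ :=
              Finset.sum_congr rfl fun j hj => hmin j (Finset.mem_filter.1 hj).2
          _ ≤ ∑ j ∈ C, min (dist (u j) (u (j + 1))) ρ :=
              Finset.sum_le_sum_of_subset_of_nonneg
                (fun j hj => (Finset.mem_filter.1 hj).2) fun i _ _ => le_min dist_nonneg hρ.le
          _ ≤ _ := hlt.le
      have hB : ∑ j ∈ firstVisits u k₀ k with ¬ j ∈ C, dist (u j) (u (j + 1)) ≤ ρ / 96 := by
        calc _ ≤ ∑ j ∈ firstVisits u k₀ k with ¬ j ∈ C, ρ / (96 * Fintype.card M) := by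
              refine Finset.sum_le_sum fun j hj => ?_
              obtain ⟨hj, hjC⟩ := Finset.mem_filter.1 hj
              obtain ⟨hj1, hj2⟩ := Finset.mem_Ico.1 (Finset.mem_filter.1 hj).1
              by_contra! hcon
              refine hjC (hC j hj1 (by omega) ?_ ?_)
              · have := (exists_tour_of_walk z u k₀ j hj1).1 j hj1 le_rfl
                have := ih j hj2 hj1 (by omega)
                linarith [dist_triangle z (u k₀) (u j)]
              · rw [div_lt_iff₀ (by positivity)] at hcon
                linarith
          _ = ((firstVisits u k₀ k).filter fun j => ¬ j ∈ C).card *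
              (ρ / (96 * Fintype.card M)) := by
              rw [Finset.sum_const, nsmul_eq_mul]
          _ ≤ Fintype.card M * (ρ / (96 * Fintype.card M)) := by
              gcongr
              exact_mod_cast (Finset.card_filter_le _ _).trans (card_firstVisits_le u k₀ k)
          _ = ρ / 96 := by field_simp
      linarith
  obtain ⟨h1, l, h2, h3⟩ := exists_tour_of_walk z u k₀ k₁ hk
  have h4 := key k₁ hk le_rfl
  exact ⟨fun i hi hi' => (h1 i hi hi').trans h4, l, h2, by linarith⟩

/-- A schedule as a walk: `u k` is the location of the server after `k` moves, and `s k` is the time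
of the next move. -/
lemma exists_walk (x : M) (l : List (ℝ × M)) (hl : l.Pairwise (fun a b => a.1 ≤ b.1)) :
    ∃ (u : ℕ → M) (s : ℕ → ℝ), u 0 = x ∧
      (∀ i j, i ≤ j → j < l.length → s i ≤ s j) ∧ (∀ i < l.length, ∃ m ∈ l, s i = m.1) ∧
      moveCost x l = ∑ j ∈ Finset.range l.length, dist (u j) (u (j + 1)) ∧
      ∀ p t, IsAt x l p t → ∃ k ≤ l.length, u k = p ∧ (∀ j < k, s j ≤ t) ∧
        ∀ j, k ≤ j → j < l.length → t ≤ s j := by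
  induction l generalizing x with
  | nil =>
    refine ⟨fun _ => x, fun _ => 0, rfl, by simp, by simp, by simp [moveCost], ?_⟩
    intro p t h
    exact ⟨0, le_rfl, h, by simp, by simp⟩
  | cons m l ih =>
    obtain ⟨hm, hl⟩ := List.pairwise_cons.1 hl
    obtain ⟨u, s, hu, hs, hsm, hcost, hat⟩ := ih m.2 hl
    refine ⟨fun k => Nat.casesOn k x u, fun k => Nat.casesOn k m.1 s, rfl, ?_, ?_, ?_, ?_⟩
    · rintro (_ | i) (_ | j) hij hj
      · exact le_rfl
      · obtain ⟨m', hm', he⟩ := hsm j (by simpa using hj)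
        change m.1 ≤ s j
        rw [he]
        exact hm m' hm'
      · omega
      · exact hs i j (by omega) (by simpa using hj)
    · rintro (_ | i) hi
      · exact ⟨m, by simp, rfl⟩
      · obtain ⟨m', hm', he⟩ := hsm i (by simpa using hi)
        exact ⟨m', List.mem_cons_of_mem _ hm', he⟩
    · rw [List.length_cons, Finset.sum_range_succ', moveCost, hcost, add_comm]
      simp [hu]
    · intro p t h
      rcases h with ⟨rfl, h⟩ | ⟨h, hrest⟩
      · refine ⟨0, by simp, rfl, by simp, ?_⟩
        rintro (_ | j) - hj
        · exact h
        · obtain ⟨m', hm', he⟩ := hsm j (by simpa using hj)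
          change t ≤ s j
          rw [he]
          exact h.trans (hm m' hm')
      · obtain ⟨k, hk, hp, h1, h2⟩ := hat p t hrest
        refine ⟨k + 1, by simpa using hk, hp, ?_, ?_⟩
        · rintro (_ | j) hj
          · exact h
          · exact h1 j (by omega)
        · rintro (_ | j) hkj hj
          · omega
          · exact h2 j (by omega) (by simpa using hj)

/-- The number of moves of a walk made up to time `t`. -/
lemma exists_moves_count (s : ℕ → ℝ) (m : ℕ) (hs : ∀ i j, i ≤ j → j < m → s i ≤ s j) (t : ℝ) :
    ∃ κ ≤ m, ∀ j < m, (j < κ ↔ s j ≤ t) := by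
  induction m with
  | zero => exact ⟨0, le_rfl, by simp⟩
  | succ m ih =>
    obtain ⟨κ, hκ, h⟩ := ih fun i j hij hj => hs i j hij (by omega)
    by_cases hm : s m ≤ t
    · exact ⟨m + 1, le_rfl, fun j hj => ⟨fun _ => (hs j m (by omega) (by omega)).trans hm,
        fun _ => hj⟩⟩
    · refine ⟨κ, by omega, fun j hj => ?_⟩
      rcases Nat.lt_succ_iff_lt_or_eq.1 hj with hj | rfl
      · exact h j hj
      · exact ⟨fun h => by omega, fun h => absurd h hm⟩

end OnlineService

namespace OnlineService

/-! ### Accrued delay and sums over requests -/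

section Requests

variable {M : Type*}

/-- The delay that `q` has accrued by time `t`, which is `0` before the release of `q`. -/
def Request.accrued (q : Request M) (t : ℝ) : ℝ := q.delay (max t q.release)

namespace Request

lemma accrued_of_release_le (q : Request M) {t : ℝ} (h : q.release ≤ t) :
    q.accrued t = q.delay t := by rw [accrued, max_eq_left h]

lemma accrued_of_le_release (q : Request M) {t : ℝ} (h : t ≤ q.release) : q.accrued t = 0 := by
  rw [accrued, max_eq_right h, q.delay_release]

lemma accrued_mono (q : Request M) : Monotone q.accrued := fun _ _ h =>
  q.delay_mono (Set.mem_Ici.2 (le_max_right _ _)) (Set.mem_Ici.2 (le_max_right _ _))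
    (max_le_max_right _ h)

lemma continuous_accrued (q : Request M) : Continuous q.accrued :=
  q.delay_cont.comp_continuous (by fun_prop) fun _ => Set.mem_Ici.2 (le_max_right _ _)

lemma tendsto_accrued (q : Request M) : Filter.Tendsto q.accrued Filter.atTop Filter.atTop :=
  q.delay_unbounded.congr' ((Filter.eventually_ge_atTop q.release).mono fun _ h =>
    (q.accrued_of_release_le h).symm)

end Request

/-- The sum of `f` over a collection of requests. -/
def reqSum (I : List (Request M)) (f : Request M → ℝ) : ℝ := (I.map f).sum

lemma reqSum_eq_sum_fin (I : List (Request M)) (f : Request M → ℝ) :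
    reqSum I f = ∑ i : Fin I.length, f I[i] :=
  (Fin.sum_univ_fun_getElem I f).symm

lemma reqSum_le_reqSum {I : List (Request M)} {f g : Request M → ℝ} (h : ∀ q ∈ I, f q ≤ g q) :
    reqSum I f ≤ reqSum I g := by
  simp only [reqSum_eq_sum_fin]
  exact Finset.sum_le_sum fun i _ => h _ (List.getElem_mem _)

lemma reqSum_congr {I : List (Request M)} {f g : Request M → ℝ} (h : ∀ q ∈ I, f q = g q) :
    reqSum I f = reqSum I g :=
  le_antisymm (reqSum_le_reqSum fun q hq => (h q hq).le) (reqSum_le_reqSum fun q hq => (h q hq).ge)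

lemma reqSum_zero (I : List (Request M)) : reqSum I (fun _ => 0) = 0 := by
  simp [reqSum_eq_sum_fin]

lemma reqSum_nonneg {I : List (Request M)} {f : Request M → ℝ} (h : ∀ q ∈ I, 0 ≤ f q) :
    0 ≤ reqSum I f := by
  rw [← reqSum_zero I]
  exact reqSum_le_reqSum h

lemma reqSum_add (I : List (Request M)) (f g : Request M → ℝ) :
    reqSum I (fun q => f q + g q) = reqSum I f + reqSum I g := by
  simp only [reqSum_eq_sum_fin, Finset.sum_add_distrib]

lemma reqSum_sub (I : List (Request M)) (f g : Request M → ℝ) :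
    reqSum I (fun q => f q - g q) = reqSum I f - reqSum I g := by
  simp only [reqSum_eq_sum_fin, Finset.sum_sub_distrib]

lemma reqSum_finsetSum (I : List (Request M)) (s : Finset ℕ) (f : ℕ → Request M → ℝ) :
    reqSum I (fun q => ∑ k ∈ s, f k q) = ∑ k ∈ s, reqSum I (f k) := by
  simp only [reqSum_eq_sum_fin]
  exact Finset.sum_comm

lemma le_reqSum_of_mem {I : List (Request M)} {f : Request M → ℝ} (h : ∀ q ∈ I, 0 ≤ f q)
    {q : Request M} (hq : q ∈ I) : f q ≤ reqSum I f := by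
  obtain ⟨n, hn, rfl⟩ := List.getElem_of_mem hq
  rw [reqSum_eq_sum_fin]
  exact Finset.single_le_sum (f := fun i : Fin I.length => f I[i])
    (fun i _ => h _ (List.getElem_mem _)) (Finset.mem_univ (⟨n, hn⟩ : Fin I.length))

lemma exists_mem_of_reqSum_pos {I : List (Request M)} {f : Request M → ℝ} (h : 0 < reqSum I f) :
    ∃ q ∈ I, 0 < f q := by
  by_contra! hcon
  have := reqSum_le_reqSum hcon
  rw [reqSum_zero] at this
  linarith

lemma reqSum_filter (I : List (Request M)) (p : Request M → Bool) {f : Request M → ℝ}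
    (h : ∀ q, ¬ p q → f q = 0) : reqSum (I.filter p) f = reqSum I f := by
  unfold reqSum
  induction I with
  | nil => rfl
  | cons q I ih =>
    by_cases hp : p q
    · rw [List.filter_cons_of_pos hp, List.map_cons, List.map_cons, List.sum_cons, List.sum_cons,
        ih]
    · rw [List.filter_cons_of_neg hp, List.map_cons, List.sum_cons, h q hp, ih, zero_add]

lemma continuous_reqSum (I : List (Request M)) {f : ℝ → Request M → ℝ}
    (h : ∀ q ∈ I, Continuous fun t => f t q) : Continuous fun t => reqSum I (f t) := by
  simp only [reqSum_eq_sum_fin]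
  exact continuous_finsetSum _ fun i _ => h _ (List.getElem_mem _)

end Requests

variable {M : Type*}

/-! ### States of the algorithm -/

/-- The state of the algorithm between two services: the location of the server, the set `live` of
the requests that were released before the last service and are considered pending, the set `fresh`
of the requests not released by then, and for each request its level (`⊥` if no service has
considered it yet) and the amount of its delay that has already been paid for. -/
structure State (M : Type*) where
  loc : M
  live : Set (Request M)
  fresh : Set (Request M)
  lvl : Request M → WithBot ℤ
  paid : Request M → ℝ
  paid_nonneg : ∀ q, 0 ≤ paid q

namespace State

/-- A request is active if it is pending. A request that is released at the location of the server
is served at once, and never becomes active. -/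
def Active (σ : State M) (q : Request M) : Prop :=
  q ∈ σ.live ∨ (q ∈ σ.fresh ∧ q.loc ≠ σ.loc)

/-- The residual delay of `q` at time `t`: the part of its delay that has not been paid for. -/
noncomputable def resid (σ : State M) (q : Request M) (t : ℝ) : ℝ :=
  max 0 (q.accrued t - σ.paid q)

/-- The amount paid for the delay of `q` once all its delay up to time `t` is paid. -/
noncomputable def paidBy (σ : State M) (t : ℝ) (q : Request M) : ℝ := max (σ.paid q) (q.accrued t)

lemma resid_nonneg (σ : State M) (q : Request M) (t : ℝ) : 0 ≤ σ.resid q t := le_max_left _ _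

lemma resid_mono (σ : State M) (q : Request M) : Monotone (σ.resid q) := fun _ _ h =>
  max_le_max_left _ (sub_le_sub_right (q.accrued_mono h) _)

lemma continuous_resid (σ : State M) (q : Request M) : Continuous (σ.resid q) :=
  continuous_const.max (q.continuous_accrued.sub continuous_const)

lemma resid_eq_zero_of_lt (σ : State M) {q : Request M} {t : ℝ} (h : t < q.release) :
    σ.resid q t = 0 := by
  rw [resid, q.accrued_of_le_release h.le]
  exact max_eq_left (by linarith [σ.paid_nonneg q])

lemma release_le_of_resid_pos (σ : State M) {q : Request M} {t : ℝ} (h : 0 < σ.resid q t) :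
    q.release ≤ t := by
  by_contra! hlt
  rw [σ.resid_eq_zero_of_lt hlt] at h
  exact lt_irrefl _ h

end State

/-! ### Prize-collecting tours -/

open Classical in
/-- The delay, beyond `base`, accrued by time `τ` by the requests with property `e` whose location
is not in the list `l`. -/
noncomputable def penalty (I : List (Request M)) (e : Request M → Prop) (base : Request M → ℝ)
    (τ : ℝ) (l : List M) : ℝ :=
  reqSum I fun q => if e q ∧ q.loc ∉ l then max 0 (q.accrued τ - base q) else 0

lemma penalty_anti (I : List (Request M)) (e : Request M → Prop) (base : Request M → ℝ)
    (τ : ℝ) {l l' : List M} (h : l ⊆ l') : penalty I e base τ l' ≤ penalty I e base τ l := by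
  refine reqSum_le_reqSum fun q _ => ?_
  split_ifs with h1 h2 h2
  · exact le_rfl
  · exact absurd ⟨h1.1, fun hq => h1.2 (h hq)⟩ h2
  · exact le_max_left _ _
  · exact le_rfl

variable [MetricSpace M]

/-- Looking ahead, there is a time `τ` up to which all delay of the given requests can be avoided at
cost `2 * B`, by serving some of them in a tour and paying the delay of the others, and at which
this cannot be done for less than `B` unless the tour serves everything. -/
lemma exists_plan (I : List (Request M)) (z : M) {B : ℝ} (hB : 0 < B) (t : ℝ)
    (e : Request M → Prop) (base : Request M → ℝ) (hbase : ∀ q, q.accrued t ≤ base q) :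
    ∃ τ, t ≤ τ ∧ ∃ l : List M, tourLen z l + penalty I e base τ l ≤ 2 * B ∧
      ((∀ q ∈ I, e q → q.loc ∈ l) ∨ ∀ l', B ≤ tourLen z l' + penalty I e base τ l') := by
  classical
  have hpen_t : ∀ l, penalty I e base t l = 0 := by
    intro l
    unfold penalty
    refine (reqSum_congr fun q _ => ?_).trans (reqSum_zero I)
    split_ifs
    · exact max_eq_left (by linarith [hbase q])
    · rfl
  by_cases hcov : ∃ l : List M, (∀ q ∈ I, e q → q.loc ∈ l) ∧ tourLen z l ≤ 2 * B
  · obtain ⟨l, hl, hlen⟩ := hcov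
    exact ⟨t, le_rfl, l, by rw [hpen_t]; linarith, Or.inl hl⟩
  push Not at hcov
  have hcont : ∀ l, Continuous fun τ => penalty I e base τ l := by
    intro l
    refine continuous_reqSum I fun q _ => ?_
    split_ifs
    · exact continuous_const.max (q.continuous_accrued.sub continuous_const)
    · exact continuous_const
  set A : Set ℝ := {s | t ≤ s ∧ ∃ l, tourLen z l + penalty I e base s l ≤ B} with hA
  have htA : t ∈ A := ⟨le_rfl, [], by
    rw [hpen_t]; simp only [tourLen, List.nil_append, pathLen, dist_self]; linarith⟩
  have hbdd : BddAbove A := by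
    have hev : ∀ᶠ s in Filter.atTop, ∀ q ∈ I, B + base q < q.accrued s := by
      have := (Filter.eventually_all_finite (l := Filter.atTop) (I := {q | q ∈ I})
        (p := fun q s => B + base q < q.accrued s) (List.finite_toSet I)).2
        fun q _ => q.tendsto_accrued.eventually_gt_atTop _
      exact this
    obtain ⟨s₀, hs₀⟩ := Filter.eventually_atTop.1 hev
    refine ⟨s₀, fun s hs => ?_⟩
    obtain ⟨-, l, hl⟩ := hs
    by_contra! hlt
    have hpen : 0 ≤ penalty I e base s l := reqSum_nonneg fun q _ => by
      split_ifs
      · exact le_max_left _ _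
      · exact le_rfl
    have : ¬ ∀ q ∈ I, e q → q.loc ∈ l := fun h => by
      have := hcov l h
      linarith
    push Not at this
    obtain ⟨q, hq, heq, hql⟩ := this
    have h1 : (if e q ∧ q.loc ∉ l then max 0 (q.accrued s - base q) else 0) ≤
        penalty I e base s l :=
      le_reqSum_of_mem (f := fun q => if e q ∧ q.loc ∉ l then max 0 (q.accrued s - base q) else 0)
        (fun q _ => by
          split_ifs
          · exact le_max_left _ _
          · exact le_rfl) hq
    rw [if_pos ⟨heq, hql⟩] at h1
    have h2 := le_max_right 0 (q.accrued s - base q)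
    have h3 := hs₀ s hlt.le q hq
    have h4 := tourLen_nonneg z l
    linarith
  set τ := sSup A with hτ
  have htτ : t ≤ τ := le_csSup hbdd htA
  refine ⟨τ, htτ, ?_⟩
  -- By continuity, a cheaper tour at `τ` would still do slightly later.
  have hlow : ∀ l', B ≤ tourLen z l' + penalty I e base τ l' := by
    intro l'
    by_contra! hlt
    have hev : ∀ᶠ s in nhds τ, tourLen z l' + penalty I e base s l' < B :=
      (continuous_const.add (hcont l')).continuousAt.eventually_lt continuousAt_const hlt
    obtain ⟨s, hs1, hs2⟩ := ((hev.filter_mono nhdsWithin_le_nhds).and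
      (self_mem_nhdsWithin (s := Set.Ioi τ) (a := τ))).exists
    have : s ∈ A := ⟨htτ.trans (le_of_lt hs2), l', hs1.le⟩
    exact absurd (le_csSup hbdd this) (not_le.2 hs2)
  -- A tour that is good slightly before `τ` is good enough at `τ`; the penalty of the empty tour
  -- bounds the growth of all penalties.
  have hev : ∀ᶠ s in nhds τ, penalty I e base τ [] < penalty I e base s [] + B :=
    continuousAt_const.eventually_lt ((hcont []).add continuous_const).continuousAt (by linarith)
  obtain ⟨δ, hδ, hball⟩ := Metric.eventually_nhds_iff.1 hev
  obtain ⟨s, hsA, hs⟩ := exists_lt_of_lt_csSup ⟨t, htA⟩ (show τ - δ < sSup A by linarith)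
  have hsτ : s ≤ τ := le_csSup hbdd hsA
  obtain ⟨-, l, hl⟩ := hsA
  refine ⟨l, ?_, Or.inr hlow⟩
  have h1 := hball (y := s) (by rw [Real.dist_eq, abs_lt]; constructor <;> linarith)
  have h2 : penalty I e base τ l - penalty I e base s l ≤
      penalty I e base τ [] - penalty I e base s [] := by
    unfold penalty
    rw [← reqSum_sub, ← reqSum_sub]
    refine reqSum_le_reqSum fun q _ => ?_
    have := max_le_max_left 0 (sub_le_sub_right (q.accrued_mono hsτ) (base q))
    by_cases h : e q
    · by_cases h' : q.loc ∈ l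
      · simp [h, h']
        simpa using this
      · simp [h, h']
    · simp [h]
  linarith

/-! ### Services -/

namespace State

/-- The active requests of level at most `j` within distance `R` of the server. -/
def Near (σ : State M) (j : ℤ) (R : ℝ) (q : Request M) : Prop :=
  σ.Active q ∧ σ.lvl q ≤ (j : WithBot ℤ) ∧ dist σ.loc q.loc ≤ R

open Classical in
/-- The total residual delay, at time `t`, of the active requests of level at most `j` within
distance `R` of the server. -/
noncomputable def load (σ : State M) (I : List (Request M)) (j : ℤ) (R t : ℝ) : ℝ :=
  reqSum I fun q => if σ.Near j R q then σ.resid q t else 0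

/-- A service is triggered on level `j` if the nearby requests of level at most `j` have residual
delay at least `8 ^ j`. -/
def Triggered (σ : State M) (I : List (Request M)) (t : ℝ) : Prop :=
  ∃ j : ℤ, (8 : ℝ) ^ j ≤ σ.load I j (8 ^ j) t

/-- The requests that take part in a service of level `ℓ` at time `t`. -/
def Eligible (σ : State M) (t : ℝ) (ℓ : ℤ) (q : Request M) : Prop :=
  q.release ≤ t ∧ σ.Near ℓ (8 * 8 ^ ℓ) q

/-- The active requests of level below `ℓ` whose distance from the server is about `8 ^ ℓ`. -/
def Far (σ : State M) (t : ℝ) (ℓ : ℤ) (q : Request M) : Prop :=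
  q.release ≤ t ∧ σ.Active q ∧ σ.lvl q < (ℓ : WithBot ℤ) ∧ (8 : ℝ) ^ ℓ / 8 < dist σ.loc q.loc ∧
    dist σ.loc q.loc ≤ 2 * 8 ^ ℓ

open Classical in
/-- The total residual delay of those far requests that lie in the set `A`. -/
noncomputable def farLoad (σ : State M) (I : List (Request M)) (t : ℝ) (ℓ : ℤ) (A : Set M) : ℝ :=
  reqSum I fun q => if σ.Far t ℓ q ∧ q.loc ∈ A then σ.resid q t else 0

/-- A point is heavy if more than half of the residual delay of the far requests is close to it. -/
def Heavy (σ : State M) (I : List (Request M)) (t : ℝ) (ℓ : ℤ) (v : M) : Prop :=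
  σ.farLoad I t ℓ Set.univ < 2 * σ.farLoad I t ℓ (Metric.closedBall v (8 ^ ℓ / 48))

end State

/-- A service: its level, the time up to which it pays for delay, the points that the server visits
before it returns to its location, and the point to which it moves in the end. -/
structure Service (M : Type*) where
  level : ℤ
  horizon : ℝ
  stops : List M
  target : M

/-- The conditions on the service that the algorithm makes at time `t`. The level is the largest one
with a substantial load. The stops and the horizon come from a prize-collecting tour. The server
stays where it is if some request of exactly the level of the service has residual delay.
Otherwise much residual delay is at far requests, and the server moves to a heavy point if there is
one. The lower bound `18` exceeds the cost `2 * 8` of the way to the eligible requests and back. The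
upper bound is `52 = 2 * 18 + 2 * 8`, for a plan of budget `18` and a detour to one more request. -/
structure Service.Valid (v : Service M) (σ : State M) (I : List (Request M)) (t : ℝ) : Prop where
  le_horizon : t ≤ v.horizon
  load_lt : ∀ j, v.level < j → σ.load I j (2 * 8 ^ j) t < 8 ^ j / 4
  cost_le : tourLen σ.loc v.stops +
    penalty I (σ.Eligible t v.level) (σ.paidBy t) v.horizon v.stops ≤ 52 * 8 ^ v.level
  le_cost : (∀ q ∈ I, σ.Eligible t v.level q → q.loc ∈ v.stops) ∨ ∀ l, 18 * 8 ^ v.level ≤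
    tourLen σ.loc l + penalty I (σ.Eligible t v.level) (σ.paidBy t) v.horizon l
  serves : ∃ q ∈ I, σ.Eligible t v.level q ∧ q.loc ∈ v.stops
  kind : ((∃ q ∈ I, σ.Active q ∧ σ.lvl q = (v.level : WithBot ℤ) ∧
      dist σ.loc q.loc ≤ 2 * 8 ^ v.level ∧ 0 < σ.resid q t) ∧ v.target = σ.loc) ∨
    ((8 : ℝ) ^ v.level / 8 ≤ σ.farLoad I t v.level Set.univ ∧
      dist σ.loc v.target ≤ 3 * 8 ^ v.level ∧
      ∀ p, σ.Heavy I t v.level p → σ.Heavy I t v.level v.target)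

namespace State

lemma Near.mono {σ : State M} {j j' : ℤ} {R R' : ℝ} {q : Request M} (h : σ.Near j R q)
    (hj : j ≤ j') (hR : R ≤ R') : σ.Near j' R' q :=
  ⟨h.1, h.2.1.trans (WithBot.coe_le_coe.2 hj), h.2.2.trans hR⟩

lemma load_mono (σ : State M) (I : List (Request M)) {j j' : ℤ} {R R' t t' : ℝ} (hj : j ≤ j')
    (hR : R ≤ R') (ht : t ≤ t') : σ.load I j R t ≤ σ.load I j' R' t' := by
  refine reqSum_le_reqSum fun q _ => ?_
  split_ifs with h1 h2 h2
  · exact σ.resid_mono q ht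
  · exact absurd (h1.mono hj hR) h2
  · exact σ.resid_nonneg q t'
  · exact le_rfl

lemma continuous_load (σ : State M) (I : List (Request M)) (j : ℤ) (R : ℝ) :
    Continuous (σ.load I j R) := by
  refine continuous_reqSum I fun q _ => ?_
  split_ifs
  · exact σ.continuous_resid q
  · exact continuous_const

lemma Triggered.mono {σ : State M} {I : List (Request M)} {t t' : ℝ} (h : σ.Triggered I t)
    (ht : t ≤ t') : σ.Triggered I t' := by
  obtain ⟨j, hj⟩ := h
  exact ⟨j, hj.trans (σ.load_mono I le_rfl le_rfl ht)⟩

lemma load_filter (σ : State M) (I : List (Request M)) {t s : ℝ} (hst : s ≤ t) (j : ℤ) (R : ℝ) :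
    σ.load (I.filter fun q => q.release ≤ t) j R s = σ.load I j R s := by
  refine reqSum_filter I _ fun q hq => ?_
  have : t < q.release := by simpa using hq
  rw [σ.resid_eq_zero_of_lt (hst.trans_lt this), ite_self]

lemma triggered_filter (σ : State M) (I : List (Request M)) {t s : ℝ} (hst : s ≤ t) :
    σ.Triggered (I.filter fun q => q.release ≤ t) s ↔ σ.Triggered I s := by
  simp only [Triggered, σ.load_filter I hst]

lemma penalty_filter (σ : State M) (I : List (Request M)) (t : ℝ) (ℓ : ℤ) (τ : ℝ) (l : List M) :
    penalty (I.filter fun q => q.release ≤ t) (σ.Eligible t ℓ) (σ.paidBy t) τ l =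
      penalty I (σ.Eligible t ℓ) (σ.paidBy t) τ l := by
  refine reqSum_filter I _ fun q hq => ?_
  have : t < q.release := by simpa using hq
  exact if_neg fun h => not_le.2 this h.1.1

lemma farLoad_filter (σ : State M) (I : List (Request M)) (t : ℝ) (ℓ : ℤ) (A : Set M) :
    σ.farLoad (I.filter fun q => q.release ≤ t) t ℓ A = σ.farLoad I t ℓ A := by
  refine reqSum_filter I _ fun q hq => ?_
  have : t < q.release := by simpa using hq
  exact if_neg fun h => not_le.2 this h.1.1

end State

/-- Whether a service is valid only depends on the requests released so far. -/
lemma Service.Valid.of_filter {v : Service M} {σ : State M} {I : List (Request M)} {t : ℝ}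
    (h : v.Valid σ (I.filter fun q => q.release ≤ t) t) : v.Valid σ I t where
  le_horizon := h.le_horizon
  load_lt j hj := by rw [← σ.load_filter I le_rfl]; exact h.load_lt j hj
  cost_le := by rw [← σ.penalty_filter]; exact h.cost_le
  le_cost := by
    refine h.le_cost.imp (fun h q hq he => h q ?_ he) fun h l => ?_
    · rw [← σ.penalty_filter]; exact h l
    · exact List.mem_filter.2 ⟨hq, by simpa using he.1⟩
  serves := by
    obtain ⟨q, hq, h⟩ := h.serves
    exact ⟨q, (List.mem_filter.1 hq).1, h⟩
  kind := by
    have hk := h.kind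
    simp only [State.Heavy, State.farLoad_filter] at hk
    refine hk.imp (fun ⟨⟨q, hq, h⟩, h'⟩ => ⟨⟨q, (List.mem_filter.1 hq).1, h⟩, h'⟩) id

/-- The largest level with a substantial load. -/
lemma State.exists_level {σ : State M} {I : List (Request M)} {t : ℝ} (h : σ.Triggered I t) :
    ∃ ℓ : ℤ, (8 : ℝ) ^ ℓ / 4 ≤ σ.load I ℓ (2 * 8 ^ ℓ) t ∧
      ∀ j, ℓ < j → σ.load I j (2 * 8 ^ j) t < 8 ^ j / 4 := by
  set W := reqSum I fun q => σ.resid q t with hW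
  have hbound : ∀ j R, σ.load I j R t ≤ W := fun j R => reqSum_le_reqSum fun q _ => by
    split_ifs
    · exact le_rfl
    · exact σ.resid_nonneg q t
  obtain ⟨N, hN⟩ := pow_unbounded_of_one_lt (4 * W) (by norm_num : (1 : ℝ) < 8)
  obtain ⟨ℓ, hℓ, hmax⟩ := Int.exists_greatest_of_bdd
    (P := fun j : ℤ => (8 : ℝ) ^ j / 4 ≤ σ.load I j (2 * 8 ^ j) t)
    ⟨N, fun j hj => by
      by_contra! hlt
      have h1 : (8 : ℝ) ^ (N : ℤ) ≤ 8 ^ j := zpow_le_zpow_right₀ (by norm_num) hlt.le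
      rw [zpow_natCast] at h1
      linarith [hbound j (2 * 8 ^ j)]⟩ (by
      obtain ⟨j, hj⟩ := h
      have hpos : (0 : ℝ) < 8 ^ j := by positivity
      refine ⟨j, ?_⟩
      have := σ.load_mono I (le_refl j) (by linarith : (8 : ℝ) ^ j ≤ 2 * 8 ^ j) (le_refl t)
      linarith)
  refine ⟨ℓ, hℓ, fun j hj => ?_⟩
  by_contra! hcon
  have := hmax j hcon
  omega

/-- If a service is triggered but no level is overloaded, then a valid service exists. -/
lemma exists_valid_service {σ : State M} {I : List (Request M)} {t : ℝ} (h : σ.Triggered I t)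
    (hle : ∀ j : ℤ, σ.load I j (8 ^ j) t ≤ 8 ^ j) : ∃ v : Service M, v.Valid σ I t := by
  classical
  obtain ⟨ℓ, hℓ, hmax⟩ := State.exists_level h
  have hr : (0 : ℝ) < 8 ^ ℓ := by positivity
  obtain ⟨q₀, hq₀, hpos⟩ := exists_mem_of_reqSum_pos (lt_of_lt_of_le (by positivity) hℓ)
  have hnear : σ.Near ℓ (2 * 8 ^ ℓ) q₀ := by
    by_contra hn
    rw [if_neg hn] at hpos
    exact lt_irrefl _ hpos
  rw [if_pos hnear] at hpos
  have hel : σ.Eligible t ℓ q₀ :=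
    ⟨σ.release_le_of_resid_pos hpos, hnear.mono le_rfl (by linarith)⟩
  obtain ⟨τ, hτ, l, hcost, hlow⟩ := exists_plan I σ.loc (B := 18 * 8 ^ ℓ) (by positivity) t
    (σ.Eligible t ℓ) (σ.paidBy t) fun q => le_max_right _ _
  have hcost' : tourLen σ.loc (q₀.loc :: l) +
      penalty I (σ.Eligible t ℓ) (σ.paidBy t) τ (q₀.loc :: l) ≤ 52 * 8 ^ ℓ := by
    have h1 := tourLen_cons_le σ.loc q₀.loc l
    have h2 := penalty_anti I (σ.Eligible t ℓ) (σ.paidBy t) τ (List.subset_cons_self q₀.loc l)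
    have h3 := hel.2.2.2
    linarith
  have hlow' : (∀ q ∈ I, σ.Eligible t ℓ q → q.loc ∈ q₀.loc :: l) ∨ ∀ l', 18 * 8 ^ ℓ ≤
      tourLen σ.loc l' + penalty I (σ.Eligible t ℓ) (σ.paidBy t) τ l' :=
    hlow.imp_left fun h q hq he => List.mem_cons_of_mem _ (h q hq he)
  by_cases hA : ∃ q ∈ I, σ.Active q ∧ σ.lvl q = (ℓ : WithBot ℤ) ∧
      dist σ.loc q.loc ≤ 2 * 8 ^ ℓ ∧ 0 < σ.resid q t
  · exact ⟨⟨ℓ, τ, q₀.loc :: l, σ.loc⟩, hτ, hmax, hcost', hlow', ⟨q₀, hq₀, hel, by simp⟩,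
      Or.inl ⟨hA, rfl⟩⟩
  -- Without residual delay on level `ℓ` itself, half of the load is at far requests, as level
  -- `ℓ - 1` is not overloaded.
  have hfar : (8 : ℝ) ^ ℓ / 8 ≤ σ.farLoad I t ℓ Set.univ := by
    have h1 := hle (ℓ - 1)
    have h8 : (8 : ℝ) ^ (ℓ - 1) = 8 ^ ℓ / 8 := by rw [zpow_sub_one₀ (by norm_num)]; ring
    rw [h8] at h1
    have h2 : σ.load I ℓ (2 * 8 ^ ℓ) t ≤
        σ.load I (ℓ - 1) (8 ^ ℓ / 8) t + σ.farLoad I t ℓ Set.univ := by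
      unfold State.load State.farLoad
      rw [← reqSum_add]
      refine reqSum_le_reqSum fun q hq => ?_
      have hnn := σ.resid_nonneg q t
      by_cases h0 : σ.resid q t = 0
      · simp [h0]
      have hp : 0 < σ.resid q t := lt_of_le_of_ne hnn (Ne.symm h0)
      by_cases hN : σ.Near ℓ (2 * 8 ^ ℓ) q
      · rw [if_pos hN]
        have hlt : σ.lvl q < (ℓ : WithBot ℤ) := lt_of_le_of_ne hN.2.1 fun he =>
          hA ⟨q, hq, hN.1, he, hN.2.2, hp⟩
        by_cases hd : dist σ.loc q.loc ≤ 8 ^ ℓ / 8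
        · have : σ.Near (ℓ - 1) (8 ^ ℓ / 8) q := by
            refine ⟨hN.1, ?_, hd⟩
            induction hb : σ.lvl q using WithBot.recBotCoe with
            | bot => exact bot_le
            | coe a =>
              rw [hb] at hlt
              have := WithBot.coe_lt_coe.1 hlt
              exact WithBot.coe_le_coe.2 (by omega)
          rw [if_pos this]
          split_ifs <;> linarith
        · have hF : σ.Far t ℓ q ∧ q.loc ∈ Set.univ :=
            ⟨⟨σ.release_le_of_resid_pos hp, hN.1, hlt, not_le.1 hd, hN.2.2⟩, Set.mem_univ _⟩
          rw [if_pos hF]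
          split_ifs <;> linarith
      · rw [if_neg hN]
        split_ifs <;> linarith
    linarith
  by_cases hv : ∃ p, σ.Heavy I t ℓ p
  · obtain ⟨p, hp⟩ := hv
    refine ⟨⟨ℓ, τ, q₀.loc :: l, p⟩, hτ, hmax, hcost', hlow', ⟨q₀, hq₀, hel, by simp⟩,
      Or.inr ⟨hfar, ?_, fun _ _ => hp⟩⟩
    have hpos : 0 < σ.farLoad I t ℓ (Metric.closedBall p (8 ^ ℓ / 48)) := by
      unfold State.Heavy at hp
      linarith
    obtain ⟨q, -, hq⟩ := exists_mem_of_reqSum_pos hpos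
    have : σ.Far t ℓ q ∧ q.loc ∈ Metric.closedBall p (8 ^ ℓ / 48) := by
      by_contra hn
      rw [if_neg hn] at hq
      exact lt_irrefl _ hq
    have h1 := this.1.2.2.2.2
    have h2 := Metric.mem_closedBall.1 this.2
    have h3 := dist_triangle σ.loc q.loc p
    change dist σ.loc p ≤ 3 * 8 ^ ℓ
    linarith
  · exact ⟨⟨ℓ, τ, q₀.loc :: l, σ.loc⟩, hτ, hmax, hcost', hlow', ⟨q₀, hq₀, hel, by simp⟩,
      Or.inr ⟨hfar, by rw [dist_self]; positivity, fun p hp => absurd ⟨p, hp⟩ hv⟩⟩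

end OnlineService

namespace OnlineService

variable {M : Type*} [MetricSpace M]

/-! ### The algorithm -/

lemma Service.Valid.dist_target_le {v : Service M} {σ : State M} {I : List (Request M)} {t : ℝ}
    (hv : v.Valid σ I t) : dist σ.loc v.target ≤ 3 * 8 ^ v.level := by
  rcases hv.kind with ⟨-, h⟩ | ⟨-, h, -⟩
  · rw [h, dist_self]; positivity
  · exact h

namespace State

open Classical in
/-- The state after the service `v` at time `t`: the eligible requests that are not served rise to
the next level, and the delay of the eligible requests up to the horizon counts as paid. -/
noncomputable def next (σ : State M) (t : ℝ) (v : Service M) : State M where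
  loc := v.target
  live := {q | q.release ≤ t ∧ σ.Active q ∧ ¬ (σ.Eligible t v.level q ∧ q.loc ∈ v.stops)}
  fresh := {q | t < q.release}
  lvl q := if σ.Eligible t v.level q then ((v.level + 1 : ℤ) : WithBot ℤ) else σ.lvl q
  paid q := if σ.Eligible t v.level q then max (σ.paid q) (q.accrued v.horizon) else σ.paid q
  paid_nonneg q := by
    split_ifs
    · exact (σ.paid_nonneg q).trans (le_max_left _ _)
    · exact σ.paid_nonneg q

lemma mem_next_live {σ : State M} {t : ℝ} {v : Service M} {q : Request M} :
    q ∈ (σ.next t v).live ↔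
      q.release ≤ t ∧ σ.Active q ∧ ¬ (σ.Eligible t v.level q ∧ q.loc ∈ v.stops) := Iff.rfl

lemma mem_next_fresh {σ : State M} {t : ℝ} {v : Service M} {q : Request M} :
    q ∈ (σ.next t v).fresh ↔ t < q.release := Iff.rfl

lemma mem_next_live_of_active {σ : State M} {t : ℝ} {v : Service M} {q : Request M}
    (h : (σ.next t v).Active q) (hq : q.release ≤ t) : q ∈ (σ.next t v).live :=
  h.resolve_right fun h' => not_lt.2 hq h'.1

lemma lvl_next_of_eligible {σ : State M} {t : ℝ} {v : Service M} {q : Request M}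
    (h : σ.Eligible t v.level q) : (σ.next t v).lvl q = ((v.level + 1 : ℤ) : WithBot ℤ) :=
  if_pos h

lemma lvl_next_of_not_eligible {σ : State M} {t : ℝ} {v : Service M} {q : Request M}
    (h : ¬ σ.Eligible t v.level q) : (σ.next t v).lvl q = σ.lvl q := if_neg h

lemma paid_next_of_eligible {σ : State M} {t : ℝ} {v : Service M} {q : Request M}
    (h : σ.Eligible t v.level q) :
    (σ.next t v).paid q = max (σ.paid q) (q.accrued v.horizon) := if_pos h

lemma paid_next_of_not_eligible {σ : State M} {t : ℝ} {v : Service M} {q : Request M}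
    (h : ¬ σ.Eligible t v.level q) : (σ.next t v).paid q = σ.paid q := if_neg h

/-- A service leaves a state in which no service is triggered at the same time. -/
lemma not_triggered_next {σ : State M} {I : List (Request M)} {t : ℝ} {v : Service M}
    (hv : v.Valid σ I t) : ¬ (σ.next t v).Triggered I t := by
  classical
  rintro ⟨j, hj⟩
  have hjpos : (0 : ℝ) < 8 ^ j := by positivity
  have hd := hv.dist_target_le
  rcases le_or_gt j v.level with hjl | hjl
  -- Requests of level at most `v.level` near the new location were eligible.
  · have h8 : (8 : ℝ) ^ j ≤ 8 ^ v.level := zpow_le_zpow_right₀ (by norm_num) hjl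
    have : (σ.next t v).load I j (8 ^ j) t = 0 := by
      refine (reqSum_congr fun q _ => ?_).trans (reqSum_zero I)
      split_ifs with hn
      · rcases lt_or_ge t q.release with hq | hq
        · exact resid_eq_zero_of_lt _ hq
        · exfalso
          obtain ⟨-, hact, -⟩ := mem_next_live.1 (mem_next_live_of_active hn.1 hq)
          have hlvl := hn.2.1
          by_cases he : σ.Eligible t v.level q
          · rw [lvl_next_of_eligible he, WithBot.coe_le_coe] at hlvl
            omega
          · rw [lvl_next_of_not_eligible he] at hlvl
            refine he ⟨hq, hact, hlvl.trans (WithBot.coe_le_coe.2 hjl), ?_⟩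
            have h1 : dist v.target q.loc ≤ 8 ^ j := hn.2.2
            linarith [dist_triangle σ.loc v.target q.loc]
      · rfl
    linarith
  -- Above, the ball of radius `8 ^ j` around the new location lies in that of radius `2 * 8 ^ j`
  -- around the old one, whose load is known to be small.
  · have h8 : (8 : ℝ) * 8 ^ v.level ≤ 8 ^ j := by
      rw [mul_comm, ← zpow_add_one₀ (by norm_num)]
      exact zpow_le_zpow_right₀ (by norm_num) (by omega)
    have hlp : (0 : ℝ) < 8 ^ v.level := by positivity
    have : (σ.next t v).load I j (8 ^ j) t ≤ σ.load I j (2 * 8 ^ j) t := by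
      refine reqSum_le_reqSum fun q _ => ?_
      have hnn : 0 ≤ if σ.Near j (2 * 8 ^ j) q then σ.resid q t else 0 := by
        split_ifs
        · exact σ.resid_nonneg q t
        · exact le_rfl
      by_cases hn : (σ.next t v).Near j (8 ^ j) q
      · rw [if_pos hn]
        rcases lt_or_ge t q.release with hq | hq
        · rw [resid_eq_zero_of_lt _ hq]; exact hnn
        · obtain ⟨-, hact, -⟩ := mem_next_live.1 (mem_next_live_of_active hn.1 hq)
          have hlvl := hn.2.1
          by_cases he : σ.Eligible t v.level q
          · have : (σ.next t v).resid q t = 0 := by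
              rw [resid, paid_next_of_eligible he]
              exact max_eq_left (by
                linarith [le_max_right (σ.paid q) (q.accrued v.horizon),
                  q.accrued_mono hv.le_horizon])
            rw [this]; exact hnn
          · rw [lvl_next_of_not_eligible he] at hlvl
            have h1 : dist v.target q.loc ≤ 8 ^ j := hn.2.2
            rw [if_pos ⟨hact, hlvl, by linarith [dist_triangle σ.loc v.target q.loc]⟩, resid,
              paid_next_of_not_eligible he]
            exact le_rfl
      · rw [if_neg hn]; exact hnn
    have := hv.load_lt j hjl
    linarith

/-- Invariants of the states of the algorithm: a request of level `⊥` at the location of the server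
is not pending, and `fresh` consists of the requests that were not released by the time of the last
service, after which no service was triggered at once. -/
structure WF (σ : State M) (I : List (Request M)) : Prop where
  ne_loc : ∀ q, σ.Active q → σ.lvl q = ⊥ → q.loc ≠ σ.loc
  fresh : σ.fresh = Set.univ ∨ ∃ t, σ.fresh = {q | t < q.release} ∧ ¬ σ.Triggered I t

lemma WF.next {σ : State M} {I : List (Request M)} {t : ℝ} {v : Service M} (hv : v.Valid σ I t) :
    (σ.next t v).WF I where
  ne_loc q hact hbot := by
    rcases hact with hq | hq
    · obtain ⟨hrel, hact, -⟩ := mem_next_live.1 hq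
      by_cases he : σ.Eligible t v.level q
      · rw [lvl_next_of_eligible he] at hbot
        exact absurd hbot (WithBot.coe_ne_bot)
      · rw [lvl_next_of_not_eligible he] at hbot
        intro hloc
        refine he ⟨hrel, hact, by rw [hbot]; exact bot_le, ?_⟩
        change q.loc = v.target at hloc
        rw [hloc]
        have : (0 : ℝ) < 8 ^ v.level := by positivity
        linarith [hv.dist_target_le]
    · exact hq.2
  fresh := Or.inr ⟨t, rfl, not_triggered_next hv⟩

lemma bddBelow_triggered (σ : State M) (I : List (Request M)) :
    BddBelow {t | σ.Triggered I t} := by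
  obtain ⟨b, hb⟩ := ((List.finite_toSet I).image Request.release).bddBelow
  refine ⟨b, fun t ⟨j, hj⟩ => ?_⟩
  obtain ⟨q, hq, hpos⟩ := exists_mem_of_reqSum_pos (lt_of_lt_of_le (by positivity) hj)
  split_ifs at hpos
  · exact (hb ⟨q, hq, rfl⟩).trans (σ.release_le_of_resid_pos hpos)
  · exact absurd hpos (lt_irrefl _)

/-- Only finitely many levels matter around any time: no request is near on very low levels, as a
request of level `⊥` is at positive distance, and on very high levels the load is too small. -/
lemma WF.eventually_not_triggered {σ : State M} {I : List (Request M)} (h : σ.WF I) {T : ℝ}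
    (hT : ¬ σ.Triggered I T) : ∀ᶠ t in nhds T, ¬ σ.Triggered I t := by
  have hlow : ∀ q, ∃ j₀ : ℤ, ∀ j < j₀, ¬ σ.Near j (8 ^ j) q := by
    intro q
    by_cases hact : σ.Active q
    · induction hb : σ.lvl q using WithBot.recBotCoe with
      | bot =>
        have hpos : 0 < dist σ.loc q.loc := dist_pos.2 (h.ne_loc q hact hb).symm
        refine ⟨Int.log 8 (dist σ.loc q.loc), fun j hj hn => ?_⟩
        have h1 : (8 : ℝ) ^ Int.log 8 (dist σ.loc q.loc) ≤ dist σ.loc q.loc := by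
          exact_mod_cast Int.zpow_log_le_self (b := 8) (by norm_num) hpos
        have h2 : (8 : ℝ) ^ j < 8 ^ Int.log 8 (dist σ.loc q.loc) :=
          zpow_lt_zpow_right₀ (by norm_num) hj
        linarith [hn.2.2]
      | coe a =>
        refine ⟨a, fun j hj hn => ?_⟩
        have := hn.2.1
        rw [hb, WithBot.coe_le_coe] at this
        omega
    · exact ⟨0, fun j _ hn => hact hn.1⟩
  choose f hf using hlow
  obtain ⟨j₀, hj₀⟩ := ((List.finite_toSet I).image f).bddBelow
  set W := reqSum I fun q => σ.resid q (T + 1) with hW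
  obtain ⟨N, hN⟩ := pow_unbounded_of_one_lt W (by norm_num : (1 : ℝ) < 8)
  have hfin : ∀ᶠ t in nhds T, ∀ j ∈ Finset.Icc j₀ (N : ℤ), σ.load I j (8 ^ j) t < 8 ^ j := by
    rw [Filter.eventually_all_finset]
    intro j _
    refine (σ.continuous_load I j (8 ^ j)).continuousAt.eventually_lt continuousAt_const ?_
    by_contra! hcon
    exact hT ⟨j, hcon⟩
  filter_upwards [hfin, eventually_le_nhds (show T < T + 1 by linarith)] with t ht ht1
  rintro ⟨j, hj⟩
  have hpos : (0 : ℝ) < 8 ^ j := by positivity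
  by_cases hjlow : j < j₀
  · have : σ.load I j (8 ^ j) t = 0 := by
      refine (reqSum_congr fun q hq => ?_).trans (reqSum_zero I)
      exact if_neg (hf q j (hjlow.trans_le (hj₀ ⟨q, hq, rfl⟩)))
    linarith
  · by_cases hjhigh : (N : ℤ) < j
    · have h1 : σ.load I j (8 ^ j) t ≤ W := reqSum_le_reqSum fun q _ => by
        split_ifs
        · exact σ.resid_mono q ht1
        · exact σ.resid_nonneg q _
      have h2 : (8 : ℝ) ^ (N : ℤ) ≤ 8 ^ j := zpow_le_zpow_right₀ (by norm_num) hjhigh.le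
      rw [zpow_natCast] at h2
      linarith
    · exact not_lt.2 hj (ht j (Finset.mem_Icc.2 ⟨by omega, by omega⟩))

/-- The first time at which a service is triggered, if there is one. -/
noncomputable def nextTime (σ : State M) (I : List (Request M)) : ℝ := sInf {t | σ.Triggered I t}

lemma WF.isLeast_nextTime {σ : State M} {I : List (Request M)} (h : σ.WF I)
    (hex : ∃ t, σ.Triggered I t) : IsLeast {t | σ.Triggered I t} (σ.nextTime I) := by
  have hglb : IsGLB {t | σ.Triggered I t} (σ.nextTime I) :=
    isGLB_csInf hex (σ.bddBelow_triggered I)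
  refine ⟨?_, hglb.1⟩
  by_contra hT
  obtain ⟨s, hs1, hs2⟩ := (((h.eventually_not_triggered hT).filter_mono nhdsWithin_le_nhds).and
    (self_mem_nhdsWithin (s := Set.Ioi (σ.nextTime I)) (a := σ.nextTime I))).exists
  obtain ⟨t, ht, hts⟩ := (isGLB_lt_iff hglb).1 hs2
  exact hs1 (Triggered.mono ht hts.le)

lemma WF.load_le {σ : State M} {I : List (Request M)} (h : σ.WF I)
    (hex : ∃ t, σ.Triggered I t) (j : ℤ) : σ.load I j (8 ^ j) (σ.nextTime I) ≤ 8 ^ j := by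
  have hl := h.isLeast_nextTime hex
  refine le_of_tendsto (x := nhdsWithin (σ.nextTime I) (Set.Iio (σ.nextTime I)))
    ((σ.continuous_load I j (8 ^ j)).continuousWithinAt) ?_
  filter_upwards [self_mem_nhdsWithin] with s hs
  by_contra! hcon
  exact not_le.2 hs (hl.2 (show σ.Triggered I s from ⟨j, hcon.le⟩))

open Classical in
/-- A valid service for the requests `L` at time `t`. (The alternative is never used.) -/
noncomputable def chooseService (σ : State M) (L : List (Request M)) (t : ℝ) : Service M :=
  if h : ∃ v : Service M, v.Valid σ L t then h.choose else ⟨0, t, [], σ.loc⟩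

/-- The next service of the algorithm, which is chosen on the basis of the requests released so
far. -/
noncomputable def nextService (σ : State M) (I : List (Request M)) : Service M :=
  σ.chooseService (I.filter fun q => q.release ≤ σ.nextTime I) (σ.nextTime I)

lemma WF.nextService_valid {σ : State M} {I : List (Request M)} (h : σ.WF I)
    (hex : ∃ t, σ.Triggered I t) : (σ.nextService I).Valid σ I (σ.nextTime I) := by
  have hl := h.isLeast_nextTime hex
  have : ∃ v : Service M, v.Valid σ (I.filter fun q => q.release ≤ σ.nextTime I)
      (σ.nextTime I) := by
    refine exists_valid_service ((σ.triggered_filter I le_rfl).2 hl.1) fun j => ?_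
    rw [σ.load_filter I le_rfl]
    exact h.load_le hex j
  refine Service.Valid.of_filter ?_
  rw [nextService, chooseService, dif_pos this]
  exact this.choose_spec

open Classical in
/-- The state after the next service, if there is one. -/
noncomputable def step (σ : State M) (I : List (Request M)) : State M :=
  if ∃ t, σ.Triggered I t then σ.next (σ.nextTime I) (σ.nextService I) else σ

open Classical in
/-- The moves of the next service, if there is one. -/
noncomputable def stepMoves (σ : State M) (I : List (Request M)) : List (ℝ × M) :=
  if ∃ t, σ.Triggered I t then
    ((σ.nextService I).stops ++ [σ.loc, (σ.nextService I).target]).map fun p => (σ.nextTime I, p)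
  else []

lemma WF.step {σ : State M} {I : List (Request M)} (h : σ.WF I) : (σ.step I).WF I := by
  unfold State.step
  split_ifs with hex
  · exact WF.next (h.nextService_valid hex)
  · exact h

lemma WF.not_triggered_step {σ : State M} {I : List (Request M)} (h : σ.WF I) {t : ℝ}
    (ht : ¬ σ.Triggered I t) : ¬ (σ.step I).Triggered I t := by
  unfold State.step
  split_ifs with hex
  · have hl := h.isLeast_nextTime hex
    have hlt : t ≤ σ.nextTime I := by
      by_contra! hlt
      exact ht (Triggered.mono hl.1 hlt.le)
    exact fun h' => not_triggered_next (h.nextService_valid hex) (h'.mono hlt)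
  · exact ht

lemma WF.lt_of_mem_stepMoves {σ : State M} {I : List (Request M)} (h : σ.WF I) {t : ℝ}
    (ht : ¬ σ.Triggered I t) {m : ℝ × M} (hm : m ∈ σ.stepMoves I) : t < m.1 := by
  unfold State.stepMoves at hm
  split_ifs at hm with hex
  · obtain ⟨p, -, rfl⟩ := List.mem_map.1 hm
    by_contra! hle
    exact ht (Triggered.mono (h.isLeast_nextTime hex).1 hle)
  · simp at hm

/-- The initial state. -/
def init (x : M) : State M where
  loc := x
  live := ∅
  fresh := Set.univ
  lvl _ := ⊥
  paid _ := 0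
  paid_nonneg _ := le_rfl

lemma WF.init (x : M) (I : List (Request M)) : (State.init x).WF I where
  ne_loc _ h _ := (h.resolve_left fun h => h).2
  fresh := Or.inl rfl

end State

/-- The state after `k` services. -/
noncomputable def stateSeq (x : M) (I : List (Request M)) : ℕ → State M
  | 0 => State.init x
  | k + 1 => (stateSeq x I k).step I

/-- The moves of the first `n` services. -/
noncomputable def movesUpTo (x : M) (I : List (Request M)) (n : ℕ) : List (ℝ × M) :=
  (List.range n).flatMap fun k => (stateSeq x I k).stepMoves I

lemma movesUpTo_succ (x : M) (I : List (Request M)) (n : ℕ) :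
    movesUpTo x I (n + 1) = movesUpTo x I n ++ (stateSeq x I n).stepMoves I := by
  simp [movesUpTo, List.range_succ]

lemma wf_stateSeq (x : M) (I : List (Request M)) (k : ℕ) : (stateSeq x I k).WF I := by
  induction k with
  | zero => exact State.WF.init x I
  | succ k ih => exact ih.step

lemma not_triggered_stateSeq (x : M) (I : List (Request M)) {k k' : ℕ} (hk : k ≤ k') {t : ℝ}
    (h : ¬ (stateSeq x I k).Triggered I t) : ¬ (stateSeq x I k').Triggered I t := by
  induction k', hk using Nat.le_induction with
  | base => exact h
  | succ k' _ ih => exact (wf_stateSeq x I k').not_triggered_step ih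

lemma State.triggered_iff_of_filter_eq (σ : State M) {I J : List (Request M)} {t s : ℝ}
    (hIJ : I.filter (fun q => q.release ≤ t) = J.filter (fun q => q.release ≤ t)) (hs : s ≤ t) :
    σ.Triggered I s ↔ σ.Triggered J s := by
  rw [← σ.triggered_filter I hs, hIJ, σ.triggered_filter J hs]

/-- A service that is triggered by time `t` only depends on the requests released by time `t`. -/
lemma State.next_eq_of_filter_eq {σ : State M} {I J : List (Request M)} {t : ℝ}
    (hI : σ.WF I) (hJ : σ.WF J)
    (hIJ : I.filter (fun q => q.release ≤ t) = J.filter (fun q => q.release ≤ t))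
    (ht : σ.Triggered I t) :
    σ.nextTime I = σ.nextTime J ∧ σ.nextService I = σ.nextService J := by
  have htJ := (σ.triggered_iff_of_filter_eq hIJ le_rfl).1 ht
  have hlI := hI.isLeast_nextTime ⟨t, ht⟩
  have hlJ := hJ.isLeast_nextTime ⟨t, htJ⟩
  have h1 := hlI.2 ht
  have h2 := hlJ.2 htJ
  have heq : σ.nextTime I = σ.nextTime J :=
    le_antisymm (hlI.2 ((σ.triggered_iff_of_filter_eq hIJ h2).2 hlJ.1))
      (hlJ.2 ((σ.triggered_iff_of_filter_eq hIJ h1).1 hlI.1))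
  refine ⟨heq, ?_⟩
  have hfilter : ∀ L : List (Request M), L.filter (fun q => q.release ≤ σ.nextTime J) =
      (L.filter fun q => q.release ≤ t).filter fun q => q.release ≤ σ.nextTime J := by
    intro L
    rw [List.filter_filter]
    refine List.filter_congr fun q _ => ?_
    by_cases h : q.release ≤ σ.nextTime J
    · simp [h, h.trans h2]
    · simp [h]
  unfold State.nextService
  rw [heq, hfilter I, hfilter J, hIJ]

lemma State.step_eq_of_filter_eq {σ : State M} {I J : List (Request M)} {t : ℝ}
    (hI : σ.WF I) (hJ : σ.WF J)
    (hIJ : I.filter (fun q => q.release ≤ t) = J.filter (fun q => q.release ≤ t))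
    (ht : σ.Triggered I t) :
    σ.step I = σ.step J ∧ σ.stepMoves I = σ.stepMoves J := by
  obtain ⟨h1, h2⟩ := State.next_eq_of_filter_eq hI hJ hIJ ht
  have htJ := (σ.triggered_iff_of_filter_eq hIJ le_rfl).1 ht
  unfold State.step State.stepMoves
  rw [if_pos ⟨t, ht⟩, if_pos ⟨t, htJ⟩, if_pos ⟨t, ht⟩, if_pos ⟨t, htJ⟩, h1, h2]
  exact ⟨rfl, rfl⟩

lemma stateSeq_eq_or_not_triggered (x : M) {I J : List (Request M)} {t : ℝ}
    (hIJ : I.filter (fun q => q.release ≤ t) = J.filter (fun q => q.release ≤ t)) (k : ℕ) :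
    stateSeq x I k = stateSeq x J k ∨
      (¬ (stateSeq x I k).Triggered I t ∧ ¬ (stateSeq x J k).Triggered J t) := by
  induction k with
  | zero => exact Or.inl rfl
  | succ k ih =>
    have hI := wf_stateSeq x I k
    have hJ := wf_stateSeq x J k
    rcases ih with h | ⟨h1, h2⟩
    · by_cases ht : (stateSeq x I k).Triggered I t
      · rw [← h] at hJ
        exact Or.inl (((State.step_eq_of_filter_eq hI hJ hIJ ht).1).trans (by rw [h]; rfl))
      · have htJ := ht
        rw [State.triggered_iff_of_filter_eq _ hIJ le_rfl, h] at htJ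
        exact Or.inr ⟨hI.not_triggered_step ht, hJ.not_triggered_step htJ⟩
    · exact Or.inr ⟨hI.not_triggered_step h1, hJ.not_triggered_step h2⟩

lemma filter_stepMoves_of_not_triggered {σ : State M} {I : List (Request M)} (h : σ.WF I) {t : ℝ}
    (ht : ¬ σ.Triggered I t) : (σ.stepMoves I).filter (fun m => m.1 ≤ t) = [] := by
  rw [List.filter_eq_nil_iff]
  intro m hm
  simpa using h.lt_of_mem_stepMoves ht hm

lemma filter_movesUpTo_eq (x : M) {I J : List (Request M)} {t : ℝ}
    (hIJ : I.filter (fun q => q.release ≤ t) = J.filter (fun q => q.release ≤ t)) (n : ℕ) :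
    (movesUpTo x I n).filter (fun m => m.1 ≤ t) = (movesUpTo x J n).filter (fun m => m.1 ≤ t) := by
  induction n with
  | zero => simp [movesUpTo]
  | succ n ih =>
    rw [movesUpTo_succ, movesUpTo_succ, List.filter_append, List.filter_append, ih]
    congr 1
    have hI := wf_stateSeq x I n
    have hJ := wf_stateSeq x J n
    rcases stateSeq_eq_or_not_triggered x hIJ n with h | ⟨h1, h2⟩
    · by_cases ht : (stateSeq x I n).Triggered I t
      · rw [← h] at hJ ⊢
        rw [(State.step_eq_of_filter_eq hI hJ hIJ ht).2]
      · have htJ := ht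
        rw [State.triggered_iff_of_filter_eq _ hIJ le_rfl, h] at htJ
        rw [filter_stepMoves_of_not_triggered hI ht, filter_stepMoves_of_not_triggered hJ htJ]
    · rw [filter_stepMoves_of_not_triggered hI h1, filter_stepMoves_of_not_triggered hJ h2]

/-! ### The number of services -/

open Classical in
/-- The number of requests that are fresh or live. -/
noncomputable def State.openCount (σ : State M) (I : List (Request M)) : ℕ :=
  (Finset.univ.filter fun i : Fin I.length => I[i] ∈ σ.live ∨ I[i] ∈ σ.fresh).card

lemma State.WF.mem_fresh_of_lt {σ : State M} {I : List (Request M)} (h : σ.WF I) {t : ℝ}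
    (ht : σ.Triggered I t) {q : Request M} (hq : t < q.release) : q ∈ σ.fresh := by
  rcases h.fresh with h | ⟨s, hs, hns⟩
  · rw [h]; exact Set.mem_univ _
  · rw [hs]
    have : s < t := by
      by_contra! hle
      exact hns (ht.mono hle)
    exact this.trans hq

/-- Each service serves a request. -/
lemma State.WF.openCount_step_lt {σ : State M} {I : List (Request M)} (h : σ.WF I)
    (hex : ∃ t, σ.Triggered I t) : (σ.step I).openCount I < σ.openCount I := by
  classical
  have hv := h.nextService_valid hex
  have hl := h.isLeast_nextTime hex
  unfold State.openCount State.step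
  rw [if_pos hex]
  refine Finset.card_lt_card ⟨fun i hi => ?_, fun hsub => ?_⟩
  · refine Finset.mem_filter.2 ⟨Finset.mem_univ _, ?_⟩
    rcases (Finset.mem_filter.1 hi).2 with hi | hi
    · exact (State.mem_next_live.1 hi).2.1.imp_right And.left
    · exact Or.inr (h.mem_fresh_of_lt hl.1 hi)
  · obtain ⟨q, hq, he, hmem⟩ := hv.serves
    obtain ⟨n, hn, rfl⟩ := List.getElem_of_mem hq
    have := hsub (Finset.mem_filter.2 ⟨Finset.mem_univ (⟨n, hn⟩ : Fin I.length),
      he.2.1.imp_right And.left⟩)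
    rcases (Finset.mem_filter.1 this).2 with hi | hi
    · exact (State.mem_next_live.1 hi).2.2 ⟨he, hmem⟩
    · exact not_lt.2 he.1 hi

lemma exists_not_triggered (x : M) (I : List (Request M)) :
    ∃ k ≤ I.length, ¬ ∃ t, (stateSeq x I k).Triggered I t := by
  by_contra! hcon
  have key : ∀ k ≤ I.length + 1, k + (stateSeq x I k).openCount I ≤ I.length := by
    intro k
    induction k with
    | zero =>
      intro _
      classical
      have h1 : (stateSeq x I 0).openCount I ≤ (Finset.univ : Finset (Fin I.length)).card := by
        unfold State.openCount
        exact Finset.card_filter_le _ _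
      simpa using h1
    | succ k ih =>
      intro hk
      have h1 := ih (by omega)
      have h2 := (wf_stateSeq x I k).openCount_step_lt (hcon k (by omega))
      change k + 1 + ((stateSeq x I k).step I).openCount I ≤ I.length
      omega
  have := key (I.length + 1) le_rfl
  omega

open Classical in
/-- The number of services that the algorithm makes. -/
noncomputable def numServices (x : M) (I : List (Request M)) : ℕ :=
  Nat.find ((exists_not_triggered x I).imp fun _ h => h.2)

lemma triggered_of_lt_numServices {x : M} {I : List (Request M)} {k : ℕ}
    (hk : k < numServices x I) : ∃ t, (stateSeq x I k).Triggered I t := by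
  classical
  by_contra hcon
  exact Nat.find_min _ hk hcon

lemma not_triggered_of_numServices_le {x : M} {I : List (Request M)} {k : ℕ}
    (hk : numServices x I ≤ k) (t : ℝ) : ¬ (stateSeq x I k).Triggered I t := by
  classical
  refine not_triggered_stateSeq x I hk fun h => ?_
  exact Nat.find_spec ((exists_not_triggered x I).imp fun _ h => h.2) ⟨t, h⟩

lemma movesUpTo_eq_of_le (x : M) (I : List (Request M)) {n : ℕ} (hn : numServices x I ≤ n) :
    movesUpTo x I n = movesUpTo x I (numServices x I) := by
  induction n, hn using Nat.le_induction with
  | base => rfl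
  | succ n hn ih =>
    rw [movesUpTo_succ, ih, State.stepMoves, if_neg, List.append_nil]
    rintro ⟨t, ht⟩
    exact not_triggered_of_numServices_le hn t ht

/-! ### The sequence of services -/

section Services

variable (x : M) (I : List (Request M))

/-- The time of service `k`. -/
noncomputable def svcTime (k : ℕ) : ℝ := (stateSeq x I k).nextTime I

/-- Service `k`. -/
noncomputable def svc (k : ℕ) : Service M := (stateSeq x I k).nextService I

variable {x I} {k k' : ℕ}

lemma svc_valid (hk : k < numServices x I) : (svc x I k).Valid (stateSeq x I k) I (svcTime x I k) :=
  (wf_stateSeq x I k).nextService_valid (triggered_of_lt_numServices hk)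

lemma stateSeq_succ (hk : k < numServices x I) :
    stateSeq x I (k + 1) = (stateSeq x I k).next (svcTime x I k) (svc x I k) :=
  if_pos (triggered_of_lt_numServices hk)

lemma stepMoves_stateSeq (hk : k < numServices x I) :
    (stateSeq x I k).stepMoves I = ((svc x I k).stops ++
      [(stateSeq x I k).loc, (svc x I k).target]).map fun p => (svcTime x I k, p) :=
  if_pos (triggered_of_lt_numServices hk)

lemma svcTime_lt_svcTime (h : k < k') (hk' : k' < numServices x I) :
    svcTime x I k < svcTime x I k' := by
  have hk := h.trans hk'
  have h1 : ¬ (stateSeq x I (k + 1)).Triggered I (svcTime x I k) := by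
    rw [stateSeq_succ hk]
    exact State.not_triggered_next (svc_valid hk)
  have h2 := not_triggered_stateSeq x I (Nat.succ_le_of_lt h) h1
  by_contra! hle
  exact h2 (State.Triggered.mono
    ((wf_stateSeq x I k').isLeast_nextTime (triggered_of_lt_numServices hk')).1 hle)

lemma time_le_of_mem_movesUpTo {n : ℕ} (hk : k < numServices x I) (hn : n ≤ k + 1)
    {m : ℝ × M} (hm : m ∈ movesUpTo x I n) : m.1 ≤ svcTime x I k := by
  obtain ⟨i, hi, hm⟩ := List.mem_flatMap.1 hm
  rw [List.mem_range] at hi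
  rw [stepMoves_stateSeq (by omega)] at hm
  obtain ⟨p, -, rfl⟩ := List.mem_map.1 hm
  rcases (show i < k ∨ i = k by omega) with h | rfl
  · exact (svcTime_lt_svcTime h hk).le
  · exact le_rfl

lemma pairwise_movesUpTo (n : ℕ) (hn : n ≤ numServices x I) :
    (movesUpTo x I n).Pairwise (fun a b => a.1 ≤ b.1) := by
  induction n with
  | zero => exact List.Pairwise.nil
  | succ n ih =>
    rw [movesUpTo_succ, stepMoves_stateSeq (by omega), List.pairwise_append]
    refine ⟨ih (by omega), ?_, fun a ha b hb => ?_⟩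
    · rw [List.pairwise_map]
      exact List.pairwise_of_forall fun _ _ => le_rfl
    · obtain ⟨p, -, rfl⟩ := List.mem_map.1 hb
      exact time_le_of_mem_movesUpTo (by omega) (by omega) ha

end Services

/-- The online algorithm, whose schedule consists of the services in the order of their times. -/
noncomputable def algorithm (M : Type*) [MetricSpace M] : OnlineAlgorithm M where
  run x I := ⟨movesUpTo x I (numServices x I), pairwise_movesUpTo _ le_rfl⟩
  online x I J t hIJ := by
    change (movesUpTo x I (numServices x I)).filter _ = (movesUpTo x J (numServices x J)).filter _
    rw [← movesUpTo_eq_of_le x I (le_max_left _ (numServices x J)),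
      ← movesUpTo_eq_of_le x J (le_max_right (numServices x I) _)]
    exact filter_movesUpTo_eq x hIJ _

end OnlineService

namespace OnlineService

/-! ### The cost of the algorithm -/

section Locations

variable {M : Type*}

/-- The final location of a server that starts at a given point and makes the listed moves. -/
def endLoc : M → List (ℝ × M) → M
  | x, [] => x
  | _, m :: l => endLoc m.2 l

lemma endLoc_append (x : M) (l l' : List (ℝ × M)) :
    endLoc x (l ++ l') = endLoc (endLoc x l) l' := by
  induction l generalizing x with
  | nil => rfl
  | cons m l ih => exact ih m.2

lemma isAt_self (x : M) {l : List (ℝ × M)} {t : ℝ} (h : ∀ m ∈ l, t ≤ m.1) : IsAt x l x t := by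
  cases l with
  | nil => rfl
  | cons m l => exact Or.inl ⟨rfl, h m (by simp)⟩

lemma isAt_append {x p : M} {l l' : List (ℝ × M)} {t : ℝ} (h : ∀ m ∈ l, m.1 ≤ t)
    (h' : IsAt (endLoc x l) l' p t) : IsAt x (l ++ l') p t := by
  induction l generalizing x with
  | nil => exact h'
  | cons m l ih =>
    exact Or.inr ⟨h m (by simp), ih (fun m' hm' => h m' (List.mem_cons_of_mem _ hm')) h'⟩

lemma isAt_of_mem {x p : M} {l : List M} {l' : List (ℝ × M)} {t : ℝ} (hp : p ∈ l)
    (h : ∀ m ∈ l', t ≤ m.1) : IsAt x (l.map (fun p => (t, p)) ++ l') p t := by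
  induction l generalizing x with
  | nil => simp at hp
  | cons y l ih =>
    rcases List.mem_cons.1 hp with rfl | hp
    · refine Or.inr ⟨le_rfl, isAt_self p fun m hm => ?_⟩
      rcases List.mem_append.1 hm with hm | hm
      · obtain ⟨p', -, rfl⟩ := List.mem_map.1 hm
        exact le_rfl
      · exact h m hm
    · exact Or.inr ⟨le_rfl, ih hp⟩

lemma endLoc_map_append_pair (x : M) (l : List M) (t : ℝ) (a b : M) :
    endLoc x ((l ++ [a, b]).map fun p => (t, p)) = b := by
  induction l generalizing x with
  | nil => rfl
  | cons y l ih => exact ih y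

lemma accrued_le_paid_add_resid (σ : State M) (q : Request M) (t : ℝ) :
    q.accrued t ≤ σ.paid q + σ.resid q t := by
  have : q.accrued t - σ.paid q ≤ σ.resid q t := le_max_right _ _
  linarith

lemma delayCost_le_of_isAt {x : M} {q : Request M} {S : Schedule M} {t : ℝ} {c : ℝ}
    (h : q.release ≤ t)
    (hat : IsAt x S.moves q.loc t) (hc : q.accrued t ≤ c) :
    delayCost x S q ≤ ENNReal.ofReal c := by
  rw [q.accrued_of_release_le h] at hc
  exact (iInf₂_le t ⟨h, hat⟩).trans (ENNReal.ofReal_le_ofReal hc)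

lemma sum_map_le_ofReal {I : List (Request M)} {f : Request M → ℝ≥0∞} {g : Request M → ℝ}
    (h : ∀ q ∈ I, f q ≤ ENNReal.ofReal (g q)) (hg : ∀ q ∈ I, 0 ≤ g q) :
    (I.map f).sum ≤ ENNReal.ofReal (reqSum I g) := by
  induction I with
  | nil => simp
  | cons q I ih =>
    have h1 := ih (fun q hq => h q (List.mem_cons_of_mem _ hq))
      fun q hq => hg q (List.mem_cons_of_mem _ hq)
    have h2 : reqSum (q :: I) g = g q + reqSum I g := by simp [reqSum]
    rw [List.map_cons, List.sum_cons, h2, ENNReal.ofReal_add (hg q (by simp))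
      (reqSum_nonneg fun q hq => hg q (List.mem_cons_of_mem _ hq))]
    exact add_le_add (h q (by simp)) h1

end Locations

variable {M : Type*} [MetricSpace M]

lemma moveCost_append (x : M) (l l' : List (ℝ × M)) :
    moveCost x (l ++ l') = moveCost x l + moveCost (endLoc x l) l' := by
  induction l generalizing x with
  | nil => simp [moveCost, endLoc]
  | cons m l ih => simp only [List.cons_append, moveCost, endLoc, ih, add_assoc]

lemma moveCost_map_append_pair (x : M) (l : List M) (t : ℝ) (a b : M) :
    moveCost x ((l ++ [a, b]).map fun p => (t, p)) = pathLen x (l ++ [a]) + dist a b := by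
  induction l generalizing x with
  | nil => simp [moveCost, pathLen]
  | cons y l ih =>
    have := ih y
    simp only [List.cons_append, List.map_cons, moveCost, pathLen] at this ⊢
    rw [this, add_assoc]

lemma State.triggered_of_active {σ : State M} {I : List (Request M)} {q : Request M} (hq : q ∈ I)
    (h : σ.Active q) : ∃ t, σ.Triggered I t := by
  classical
  have hj : ∃ j : ℤ, σ.Near j (8 ^ j) q := by
    obtain ⟨n, hn⟩ := pow_unbounded_of_one_lt (dist σ.loc q.loc) (by norm_num : (1 : ℝ) < 8)
    have key : ∀ j : ℤ, (n : ℤ) ≤ j → dist σ.loc q.loc ≤ 8 ^ j := fun j hj => by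
      have : (8 : ℝ) ^ (n : ℤ) ≤ 8 ^ j := zpow_le_zpow_right₀ (by norm_num) hj
      rw [zpow_natCast] at this
      linarith
    induction hb : σ.lvl q using WithBot.recBotCoe with
    | bot => exact ⟨n, h, by rw [hb]; exact bot_le, key n le_rfl⟩
    | coe a =>
      exact ⟨max a n, h, by rw [hb]; exact WithBot.coe_le_coe.2 (le_max_left _ _),
        key _ (le_max_right _ _)⟩
  obtain ⟨j, hj⟩ := hj
  obtain ⟨t, ht⟩ := (q.tendsto_accrued.eventually_ge_atTop (8 ^ j + σ.paid q)).exists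
  refine ⟨t, j, ?_⟩
  have h1 := le_reqSum_of_mem (I := I)
    (f := fun q => if σ.Near j (8 ^ j) q then σ.resid q t else 0) (fun q _ => by
      split_ifs
      · exact σ.resid_nonneg q t
      · exact le_rfl) hq
  rw [if_pos hj] at h1
  have h2 : σ.resid q t ≤ σ.load I j (8 ^ j) t := by
    unfold State.load
    convert h1
  have h3 : q.accrued t - σ.paid q ≤ σ.resid q t := le_max_right _ _
  linarith

section Cost

variable {x : M} {I : List (Request M)} {k i : ℕ} {q : Request M}

lemma loc_stateSeq_succ (hk : k < numServices x I) :
    (stateSeq x I (k + 1)).loc = (svc x I k).target := by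
  rw [stateSeq_succ hk]
  rfl

lemma endLoc_movesUpTo (hk : k ≤ numServices x I) :
    endLoc x (movesUpTo x I k) = (stateSeq x I k).loc := by
  induction k with
  | zero => rfl
  | succ k ih =>
    rw [movesUpTo_succ, endLoc_append, stepMoves_stateSeq (by omega), endLoc_map_append_pair,
      loc_stateSeq_succ (by omega)]

lemma exists_movesUpTo_append {n : ℕ} (hkn : k ≤ n) (hn : n ≤ numServices x I) :
    ∃ rest, movesUpTo x I n = movesUpTo x I k ++ rest ∧
      ∀ m ∈ rest, k < numServices x I ∧ svcTime x I k ≤ m.1 := by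
  induction n, hkn using Nat.le_induction with
  | base => exact ⟨[], by simp⟩
  | succ n hkn ih =>
    obtain ⟨rest, h1, h2⟩ := ih (by omega)
    refine ⟨rest ++ (stateSeq x I n).stepMoves I, by rw [movesUpTo_succ, h1, List.append_assoc],
      fun m hm => ?_⟩
    rcases List.mem_append.1 hm with hm | hm
    · exact h2 m hm
    · rw [stepMoves_stateSeq (by omega)] at hm
      obtain ⟨p, -, rfl⟩ := List.mem_map.1 hm
      refine ⟨by omega, ?_⟩
      rcases hkn.eq_or_lt with rfl | h
      · exact le_rfl
      · exact (svcTime_lt_svcTime h (by omega)).le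

lemma le_release_of_mem_fresh (hk : k ≤ numServices x I) (hq : q ∈ (stateSeq x I k).fresh)
    {m : ℝ × M} (hm : m ∈ movesUpTo x I k) : m.1 ≤ q.release := by
  cases k with
  | zero => simp [movesUpTo] at hm
  | succ k =>
    rw [stateSeq_succ (by omega), State.mem_next_fresh] at hq
    exact (time_le_of_mem_movesUpTo (by omega) le_rfl hm).trans hq.le

/-- A request that is active after service `i`, and was released by then, is not served by it. -/
lemma mem_live_succ (hik : i < k) (hk : k ≤ numServices x I) (hrel : q.release ≤ svcTime x I i)
    (hact : (stateSeq x I k).Active q) : q ∈ (stateSeq x I (i + 1)).live := by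
  induction k, Nat.succ_le_of_lt hik using Nat.le_induction with
  | base =>
    rw [stateSeq_succ (by omega)] at hact ⊢
    exact State.mem_next_live_of_active hact hrel
  | succ k hik' ih =>
    have hik' : i < k := hik'
    refine ih hik' (by omega) ?_
    rw [stateSeq_succ (by omega)] at hact
    exact (State.mem_next_live.1 (State.mem_next_live_of_active hact
      (hrel.trans (svcTime_lt_svcTime hik' (by omega)).le))).2.1

lemma active_of_active (hik : i ≤ k) (hk : k < numServices x I) (hrel : q.release ≤ svcTime x I i)
    (hact : (stateSeq x I k).Active q) : (stateSeq x I i).Active q := by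
  rcases hik.eq_or_lt with rfl | hik
  · exact hact
  · have := mem_live_succ hik hk.le hrel hact
    rw [stateSeq_succ (by omega)] at this
    exact (State.mem_next_live.1 this).2.1

open Classical in
variable (x I) in
/-- The amount that the algorithm pays in service `k` for the delay of `q`: all residual delay if
`q` is eligible, and the delay up to the horizon if `q` is not served. -/
noncomputable def payment (k : ℕ) (q : Request M) : ℝ :=
  if (stateSeq x I k).Eligible (svcTime x I k) (svc x I k).level q then
    (stateSeq x I k).resid q (svcTime x I k) + if q.loc ∉ (svc x I k).stops then
      max 0 (q.accrued (svc x I k).horizon - (stateSeq x I k).paidBy (svcTime x I k) q) else 0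
  else 0

lemma payment_nonneg (k : ℕ) (q : Request M) : 0 ≤ payment x I k q := by
  have := (stateSeq x I k).resid_nonneg q (svcTime x I k)
  unfold payment
  split_ifs
  · rwa [add_zero]
  · exact add_nonneg this (le_max_left _ _)
  · exact le_rfl

lemma paid_le_sum_payment (hk : k ≤ numServices x I) (hact : (stateSeq x I k).Active q) :
    (stateSeq x I k).paid q ≤ ∑ j ∈ Finset.range k, payment x I j q := by
  have key : ∀ i ≤ k, (stateSeq x I i).paid q ≤ ∑ j ∈ Finset.range i, payment x I j q := by
    intro i
    induction i with
    | zero => intro _; exact le_rfl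
    | succ i ih =>
      intro hi
      rw [Finset.sum_range_succ, stateSeq_succ (by omega)]
      have h1 := ih (by omega)
      by_cases he : (stateSeq x I i).Eligible (svcTime x I i) (svc x I i).level q
      · have hlive := mem_live_succ (Nat.lt_of_succ_le hi) hk he.1 hact
        rw [stateSeq_succ (by omega)] at hlive
        have hns : q.loc ∉ (svc x I i).stops := fun hs =>
          (State.mem_next_live.1 hlive).2.2 ⟨he, hs⟩
        rw [State.paid_next_of_eligible he, payment, if_pos he, if_pos hns]
        have h2 := (stateSeq x I i).resid_nonneg q (svcTime x I i)
        have h3 := le_max_left 0 (q.accrued (svc x I i).horizon -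
          (stateSeq x I i).paidBy (svcTime x I i) q)
        have h4 := le_max_right 0 (q.accrued (svc x I i).horizon -
          (stateSeq x I i).paidBy (svcTime x I i) q)
        have h5 := accrued_le_paid_add_resid (stateSeq x I i) q (svcTime x I i)
        have h6 : (stateSeq x I i).paidBy (svcTime x I i) q ≤
            (stateSeq x I i).paid q + (stateSeq x I i).resid q (svcTime x I i) :=
          max_le (by linarith) h5
        exact max_le (by linarith) (by linarith)
      · rw [State.paid_next_of_not_eligible he]
        linarith [payment_nonneg (x := x) (I := I) i q]
  exact key k le_rfl

/-- A request released while the server is at its location has no delay. -/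
lemma delayCost_le_zero_of_mem_fresh (hk : k ≤ numServices x I) (hq : q ∈ (stateSeq x I k).fresh)
    (hloc : q.loc = (stateSeq x I k).loc)
    (hrel : k < numServices x I → q.release ≤ svcTime x I k) :
    delayCost x ((algorithm M).run x I) q ≤ ENNReal.ofReal 0 := by
  refine delayCost_le_of_isAt le_rfl ?_ (q.accrued_of_le_release le_rfl).le
  change IsAt x (movesUpTo x I (numServices x I)) q.loc q.release
  obtain ⟨rest, h1, h2⟩ := exists_movesUpTo_append hk le_rfl
  rw [h1]
  refine isAt_append (fun m hm => le_release_of_mem_fresh hk hq hm) ?_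
  rw [endLoc_movesUpTo hk, hloc]
  exact isAt_self _ fun m hm => (hrel (h2 m hm).1).trans (h2 m hm).2

lemma delayCost_algorithm_le (hq : q ∈ I) :
    delayCost x ((algorithm M).run x I) q ≤
      ENNReal.ofReal (∑ k ∈ Finset.range (numServices x I), payment x I k q) := by
  have hsum : 0 ≤ ∑ k ∈ Finset.range (numServices x I), payment x I k q :=
    Finset.sum_nonneg fun k _ => payment_nonneg k q
  by_cases hdrop : ∃ k < numServices x I,
      (q ∈ (stateSeq x I k).live ∨ q ∈ (stateSeq x I k).fresh) ∧
      ¬ (q ∈ (stateSeq x I (k + 1)).live ∨ q ∈ (stateSeq x I (k + 1)).fresh)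
  · obtain ⟨k, hk, hopen, hclosed⟩ := hdrop
    rw [stateSeq_succ hk, State.mem_next_live, State.mem_next_fresh, not_or, not_lt] at hclosed
    obtain ⟨hnl, hrel⟩ := hclosed
    by_cases hact : (stateSeq x I k).Active q
    · have hserved : (stateSeq x I k).Eligible (svcTime x I k) (svc x I k).level q ∧
          q.loc ∈ (svc x I k).stops := by
        by_contra hn
        exact hnl ⟨hrel, hact, hn⟩
      refine delayCost_le_of_isAt (t := svcTime x I k) hrel ?_ ?_
      · change IsAt x (movesUpTo x I (numServices x I)) q.loc (svcTime x I k)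
        obtain ⟨rest, h1, h2⟩ := exists_movesUpTo_append (Nat.succ_le_of_lt hk) le_rfl
        rw [h1, movesUpTo_succ, List.append_assoc, stepMoves_stateSeq hk]
        refine isAt_append (fun m hm => time_le_of_mem_movesUpTo hk (Nat.le_succ k) hm) ?_
        refine isAt_of_mem (List.mem_append_left _ hserved.2) fun m hm => ?_
        obtain ⟨h3, h4⟩ := h2 m hm
        exact (svcTime_lt_svcTime (Nat.lt_succ_self k) h3).le.trans h4
      · have h1 := paid_le_sum_payment hk.le hact
        have h2 := accrued_le_paid_add_resid (stateSeq x I k) q (svcTime x I k)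
        have h3 : (stateSeq x I k).resid q (svcTime x I k) = payment x I k q := by
          rw [payment, if_pos hserved.1, if_neg (not_not.2 hserved.2), add_zero]
        have h4 : ∑ j ∈ Finset.range (k + 1), payment x I j q ≤
            ∑ k ∈ Finset.range (numServices x I), payment x I k q :=
          Finset.sum_le_sum_of_subset_of_nonneg (Finset.range_subset_range.2 hk)
            fun j _ _ => payment_nonneg j q
        rw [Finset.sum_range_succ] at h4
        linarith
    · have hfresh := hopen.resolve_left fun h => hact (Or.inl h)
      have hloc : q.loc = (stateSeq x I k).loc := by
        by_contra hne
        exact hact (Or.inr ⟨hfresh, hne⟩)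
      exact (delayCost_le_zero_of_mem_fresh hk.le hfresh hloc fun _ => hrel).trans
        (ENNReal.ofReal_le_ofReal hsum)
  · push Not at hdrop
    have hopen : ∀ k ≤ numServices x I,
        q ∈ (stateSeq x I k).live ∨ q ∈ (stateSeq x I k).fresh := by
      intro k
      induction k with
      | zero => intro _; exact Or.inr (Set.mem_univ q)
      | succ k ih => intro hk; exact hdrop k hk (ih (by omega))
    have hact : ¬ (stateSeq x I (numServices x I)).Active q := fun h => by
      obtain ⟨t, ht⟩ := State.triggered_of_active hq h
      exact not_triggered_of_numServices_le le_rfl t ht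
    have hfresh := (hopen _ le_rfl).resolve_left fun h => hact (Or.inl h)
    have hloc : q.loc = (stateSeq x I (numServices x I)).loc := by
      by_contra hne
      exact hact (Or.inr ⟨hfresh, hne⟩)
    exact (delayCost_le_zero_of_mem_fresh le_rfl hfresh hloc fun h => absurd h (lt_irrefl _)).trans
      (ENNReal.ofReal_le_ofReal hsum)

lemma moveCost_movesUpTo (hk : k ≤ numServices x I) :
    moveCost x (movesUpTo x I k) = ∑ j ∈ Finset.range k,
      (tourLen (stateSeq x I j).loc (svc x I j).stops +
        dist (stateSeq x I j).loc (svc x I j).target) := by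
  induction k with
  | zero => simp [movesUpTo, moveCost]
  | succ k ih =>
    rw [movesUpTo_succ, moveCost_append, ih (by omega), Finset.sum_range_succ,
      endLoc_movesUpTo (by omega), stepMoves_stateSeq (by omega), moveCost_map_append_pair]
    rfl

lemma reqSum_payment_le (hk : k < numServices x I) :
    reqSum I (payment x I k) ≤ 2 * 8 ^ (svc x I k).level +
      penalty I ((stateSeq x I k).Eligible (svcTime x I k) (svc x I k).level)
        ((stateSeq x I k).paidBy (svcTime x I k)) (svc x I k).horizon (svc x I k).stops := by
  have hv := svc_valid hk
  have h1 := hv.load_lt _ (lt_add_one _)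
  have h8 : (8 : ℝ) ^ ((svc x I k).level + 1) = 8 ^ (svc x I k).level * 8 :=
    zpow_add_one₀ (by norm_num) _
  have hpos : (0 : ℝ) < 8 ^ (svc x I k).level := by positivity
  have h2 : reqSum I (payment x I k) ≤
      (stateSeq x I k).load I ((svc x I k).level + 1) (2 * 8 ^ ((svc x I k).level + 1))
        (svcTime x I k) +
      penalty I ((stateSeq x I k).Eligible (svcTime x I k) (svc x I k).level)
        ((stateSeq x I k).paidBy (svcTime x I k)) (svc x I k).horizon (svc x I k).stops := by
    unfold State.load penalty
    rw [← reqSum_add]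
    refine reqSum_le_reqSum fun q _ => ?_
    unfold payment
    by_cases he : (stateSeq x I k).Eligible (svcTime x I k) (svc x I k).level q
    · have hn : (stateSeq x I k).Near ((svc x I k).level + 1)
          (2 * 8 ^ ((svc x I k).level + 1)) q := he.2.mono (by omega) (by rw [h8]; linarith)
      rw [if_pos he, if_pos hn]
      by_cases hs : q.loc ∈ (svc x I k).stops <;> simp [he, hs]
    · simp only [he, if_false, false_and, add_zero]
      split_ifs
      · exact (stateSeq x I k).resid_nonneg q _
      · exact le_rfl
  linarith

variable (x I) in
/-- The cost of the algorithm is bounded by the scales of its services. -/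
lemma cost_algorithm_le : cost x I ((algorithm M).run x I) ≤
    ENNReal.ofReal (57 * ∑ k ∈ Finset.range (numServices x I), 8 ^ (svc x I k).level) := by
  have h1 : ENNReal.ofReal (moveCost x ((algorithm M).run x I).moves) ≤
      ENNReal.ofReal (∑ j ∈ Finset.range (numServices x I),
      (tourLen (stateSeq x I j).loc (svc x I j).stops +
        dist (stateSeq x I j).loc (svc x I j).target)) :=
    ENNReal.ofReal_le_ofReal (moveCost_movesUpTo le_rfl).le
  have h2 : (I.map (delayCost x ((algorithm M).run x I))).sum ≤ ENNReal.ofReal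
      (reqSum I fun q => ∑ k ∈ Finset.range (numServices x I), payment x I k q) :=
    sum_map_le_ofReal (fun q hq => delayCost_algorithm_le hq)
      fun q _ => Finset.sum_nonneg fun k _ => payment_nonneg k q
  refine (add_le_add h1 h2).trans ?_
  rw [← ENNReal.ofReal_add (Finset.sum_nonneg fun j _ => add_nonneg (tourLen_nonneg _ _)
      dist_nonneg) (reqSum_nonneg fun q _ => Finset.sum_nonneg fun k _ => payment_nonneg k q),
    reqSum_finsetSum, ← Finset.sum_add_distrib, Finset.mul_sum]
  refine ENNReal.ofReal_le_ofReal (Finset.sum_le_sum fun k hk => ?_)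
  have hk := Finset.mem_range.1 hk
  have hv := svc_valid hk
  linarith [reqSum_payment_le hk, hv.cost_le, hv.dist_target_le]

end Cost

end OnlineService

namespace OnlineService

variable {M : Type*} [MetricSpace M]

/-! ### Levels and paid delay over time -/

section History

variable {x : M} {I : List (Request M)} {k k' i : ℕ} {q : Request M}

lemma lvl_le_lvl_succ (hk : k < numServices x I) (q : Request M) :
    (stateSeq x I k).lvl q ≤ (stateSeq x I (k + 1)).lvl q := by
  rw [stateSeq_succ hk]
  by_cases he : (stateSeq x I k).Eligible (svcTime x I k) (svc x I k).level q
  · rw [State.lvl_next_of_eligible he]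
    exact he.2.2.1.trans (WithBot.coe_le_coe.2 (by omega))
  · rw [State.lvl_next_of_not_eligible he]

lemma lvl_mono (h : k ≤ k') (hk' : k' ≤ numServices x I) (q : Request M) :
    (stateSeq x I k).lvl q ≤ (stateSeq x I k').lvl q := by
  induction k', h using Nat.le_induction with
  | base => exact le_rfl
  | succ k' _ ih => exact (ih (by omega)).trans (lvl_le_lvl_succ (by omega) q)

lemma paid_le_paid_succ (hk : k < numServices x I) (q : Request M) :
    (stateSeq x I k).paid q ≤ (stateSeq x I (k + 1)).paid q := by
  rw [stateSeq_succ hk]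
  by_cases he : (stateSeq x I k).Eligible (svcTime x I k) (svc x I k).level q
  · rw [State.paid_next_of_eligible he]
    exact le_max_left _ _
  · rw [State.paid_next_of_not_eligible he]

lemma paid_mono (h : k ≤ k') (hk' : k' ≤ numServices x I) (q : Request M) :
    (stateSeq x I k).paid q ≤ (stateSeq x I k').paid q := by
  induction k', h using Nat.le_induction with
  | base => exact le_rfl
  | succ k' _ ih => exact (ih (by omega)).trans (paid_le_paid_succ (by omega) q)

/-- A service either serves the nearby requests of at most its level or raises them above its level.
So a request that still is active and of at most that level was far away, or released later. -/
lemma lt_dist_of_active (hik : i < k) (hk : k < numServices x I) (hrel : q.release ≤ svcTime x I i)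
    (hact : (stateSeq x I k).Active q)
    (hlvl : (stateSeq x I k).lvl q ≤ ((svc x I i).level : WithBot ℤ)) :
    8 * 8 ^ (svc x I i).level < dist (stateSeq x I i).loc q.loc := by
  by_contra! hd
  have he : (stateSeq x I i).Eligible (svcTime x I i) (svc x I i).level q :=
    ⟨hrel, active_of_active hik.le hk hrel hact, (lvl_mono hik.le hk.le q).trans hlvl, hd⟩
  have h1 := (lvl_mono hik hk.le q).trans hlvl
  rw [stateSeq_succ (by omega), State.lvl_next_of_eligible he, WithBot.coe_le_coe] at h1
  omega

lemma exists_eligible_of_lvl_eq {ℓ : ℤ} (hk : k ≤ numServices x I)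
    (h : (stateSeq x I k).lvl q = (ℓ : WithBot ℤ)) :
    ∃ i < k, (stateSeq x I i).Eligible (svcTime x I i) (svc x I i).level q ∧
      (svc x I i).level + 1 = ℓ := by
  induction k with
  | zero => exact absurd h.symm WithBot.coe_ne_bot
  | succ k ih =>
    rw [stateSeq_succ (by omega)] at h
    by_cases he : (stateSeq x I k).Eligible (svcTime x I k) (svc x I k).level q
    · rw [State.lvl_next_of_eligible he] at h
      exact ⟨k, Nat.lt_succ_self k, he, WithBot.coe_injective h⟩
    · rw [State.lvl_next_of_not_eligible he] at h
      obtain ⟨i, hi, h⟩ := ih (by omega) h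
      exact ⟨i, by omega, h⟩

/-! ### Local services -/

variable (x I) in
/-- A service is local if some nearby request of exactly its level has residual delay, and the
server stays where it is. -/
def LocalSvc (k : ℕ) : Prop :=
  (∃ q ∈ I, (stateSeq x I k).Active q ∧
    (stateSeq x I k).lvl q = ((svc x I k).level : WithBot ℤ) ∧
    dist (stateSeq x I k).loc q.loc ≤ 2 * 8 ^ (svc x I k).level ∧
    0 < (stateSeq x I k).resid q (svcTime x I k)) ∧ (svc x I k).target = (stateSeq x I k).loc

variable (x I) in
/-- Service `i` is the reason for the local service `k`: it did not serve `q`, but raised it to the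
level of `k` and paid for its delay up to a horizon, which ends before `k`. -/
structure IsOrigin (k i : ℕ) (q : Request M) : Prop where
  lt : i < k
  mem : q ∈ I
  level_eq : (svc x I i).level + 1 = (svc x I k).level
  eligible : (stateSeq x I i).Eligible (svcTime x I i) (svc x I i).level q
  active : (stateSeq x I k).Active q
  lvl_eq : (stateSeq x I k).lvl q = ((svc x I k).level : WithBot ℤ)
  dist_le : dist (stateSeq x I k).loc q.loc ≤ 2 * 8 ^ (svc x I k).level
  horizon_lt : (svc x I i).horizon < svcTime x I k
  not_served : q.loc ∉ (svc x I i).stops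

lemma LocalSvc.exists_isOrigin (hk : k < numServices x I) (h : LocalSvc x I k) :
    ∃ i q, IsOrigin x I k i q := by
  obtain ⟨⟨q, hq, hact, hlvl, hd, hres⟩, -⟩ := h
  obtain ⟨i, hi, he, hlev⟩ := exists_eligible_of_lvl_eq hk.le hlvl
  refine ⟨i, q, hi, hq, hlev, he, hact, hlvl, hd, ?_, fun hs => ?_⟩
  · by_contra! hle
    have h1 := paid_mono (Nat.succ_le_of_lt hi) hk.le q
    rw [stateSeq_succ (by omega), State.paid_next_of_eligible he] at h1
    have h2 := (le_max_right _ _).trans h1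
    have h3 := q.accrued_mono hle
    have h4 : (stateSeq x I k).resid q (svcTime x I k) = 0 := max_eq_left (by linarith)
    linarith
  · have hlive := mem_live_succ hi hk.le he.1 hact
    rw [stateSeq_succ (by omega)] at hlive
    exact (State.mem_next_live.1 hlive).2.2 ⟨he, hs⟩

lemma IsOrigin.pow_eq (h : IsOrigin x I k i q) :
    (8 : ℝ) ^ (svc x I k).level = 8 * 8 ^ (svc x I i).level := by
  rw [← h.level_eq, zpow_add_one₀ (by norm_num), mul_comm]

/-- For two local services of the same level with origins close to each other, the requests
considered by the later origin are released after the earlier service. -/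
lemma IsOrigin.svcTime_lt_release {k₁ k₂ i₁ i₂ : ℕ} {q₁ q₂ : Request M}
    (h₁ : IsOrigin x I k₁ i₁ q₁) (h₂ : IsOrigin x I k₂ i₂ q₂) (hk : k₁ < k₂)
    (hk₂ : k₂ < numServices x I) (hlev : (svc x I i₁).level = (svc x I i₂).level)
    (hd : dist (stateSeq x I i₁).loc (stateSeq x I i₂).loc ≤ 18 * 8 ^ (svc x I i₁).level)
    {q : Request M} (he : (stateSeq x I i₂).Eligible (svcTime x I i₂) (svc x I i₂).level q) :
    svcTime x I k₁ < q.release := by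
  have hpos : (0 : ℝ) < 8 ^ (svc x I i₁).level := by positivity
  have hl1 := h₁.level_eq
  have hl2 := h₂.level_eq
  -- The eligible requests of `i₂` lie in the range of the service `k₁`.
  have hclose : ∀ q' : Request M,
      (stateSeq x I i₂).Eligible (svcTime x I i₂) (svc x I i₂).level q' →
      ¬ 8 * 8 ^ (svc x I k₁).level < dist (stateSeq x I k₁).loc q'.loc := by
    intro q' he'
    have e1 := h₁.dist_le
    have e2 := h₁.eligible.2.2.2
    have e3 := he'.2.2.2
    rw [← hlev] at e3
    rw [h₁.pow_eq] at e1 ⊢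
    have t1 := dist_triangle (stateSeq x I k₁).loc q₁.loc q'.loc
    have t2 := dist_triangle q₁.loc (stateSeq x I i₁).loc q'.loc
    have t3 := dist_triangle (stateSeq x I i₁).loc (stateSeq x I i₂).loc q'.loc
    rw [dist_comm q₁.loc (stateSeq x I i₁).loc] at t2
    linarith
  by_contra! hrel
  rcases lt_trichotomy i₂ k₁ with hlt | heq | hgt
  · refine hclose q₂ h₂.eligible (lt_dist_of_active hk hk₂ ?_ h₂.active ?_)
    · exact h₂.eligible.1.trans (svcTime_lt_svcTime hlt (hk.trans hk₂)).le
    · rw [h₂.lvl_eq, WithBot.coe_le_coe]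
      omega
  · rw [heq] at hlev
    omega
  · refine hclose q he (lt_dist_of_active hgt (h₂.lt.trans hk₂) hrel he.2.1 ?_)
    exact he.2.2.1.trans (WithBot.coe_le_coe.2 (by omega))

lemma IsOrigin.injective {k₁ k₂ i : ℕ} {q₁ q₂ : Request M}
    (h₁ : IsOrigin x I k₁ i q₁) (h₂ : IsOrigin x I k₂ i q₂)
    (hk₁ : k₁ < numServices x I) (hk₂ : k₂ < numServices x I) : k₁ = k₂ := by
  have key : ∀ {k₁ k₂ : ℕ} {q₁ q₂ : Request M}, IsOrigin x I k₁ i q₁ → IsOrigin x I k₂ i q₂ →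
      k₂ < numServices x I → ¬ k₁ < k₂ := by
    intro k₁ k₂ q₁ q₂ h₁ h₂ hk₂ hlt
    have h := h₁.svcTime_lt_release h₂ hlt hk₂ rfl (by rw [dist_self]; positivity) h₂.eligible
    have h' := svcTime_lt_svcTime h₁.lt (hlt.trans hk₂)
    linarith [h₂.eligible.1]
  have := key h₁ h₂ hk₂
  have := key h₂ h₁ hk₁
  omega

end History

/-! ### Charging to a schedule -/

/-- What the analysis uses about a fixed schedule: it is a walk `u` that makes its moves at the
times `s`, and by time `τ` it has visited every request for which it does not pay the delay accrued
by `τ`. -/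
structure Offline (x : M) (I : List (Request M)) where
  len : ℕ
  u : ℕ → M
  s : ℕ → ℝ
  delay : Request M → ℝ
  u_zero : u 0 = x
  s_mono : ∀ i j, i ≤ j → j < len → s i ≤ s j
  delay_nonneg : ∀ q, 0 ≤ delay q
  exists_visit : ∀ q ∈ I, ∀ τ, delay q < q.accrued τ → ∃ a ≤ len, u a = q.loc ∧
    (∀ j < a, s j ≤ τ) ∧ ∀ j, a ≤ j → j < len → q.release ≤ s j

namespace Offline

variable {x : M} {I : List (Request M)} (w : Offline x I)

/-- The length of a move. -/
noncomputable def d (j : ℕ) : ℝ := dist (w.u j) (w.u (j + 1))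

/-- The part of the delay of the schedule that is paid for in service `k` of the algorithm. -/
noncomputable def delayShare (k : ℕ) : ℝ := reqSum I fun q =>
  min (w.delay q) ((stateSeq x I (k + 1)).paid q) - min (w.delay q) ((stateSeq x I k).paid q)

variable {w} in
lemma delayShare_term_nonneg {k : ℕ} (hk : k < numServices x I) (q : Request M) :
    0 ≤ min (w.delay q) ((stateSeq x I (k + 1)).paid q) -
      min (w.delay q) ((stateSeq x I k).paid q) :=
  sub_nonneg.2 (min_le_min_left _ (paid_le_paid_succ hk q))

lemma delayShare_nonneg {k : ℕ} (hk : k < numServices x I) : 0 ≤ w.delayShare k :=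
  reqSum_nonneg fun q _ => delayShare_term_nonneg hk q

/-- No part of the delay of the schedule is charged twice. -/
lemma sum_delayShare_le :
    ∑ k ∈ Finset.range (numServices x I), w.delayShare k ≤ reqSum I w.delay := by
  unfold delayShare
  rw [← reqSum_finsetSum]
  refine reqSum_le_reqSum fun q _ => ?_
  rw [Finset.sum_range_sub (fun k => min (w.delay q) ((stateSeq x I k).paid q))]
  have h1 : min (w.delay q) ((stateSeq x I (numServices x I)).paid q) ≤ w.delay q :=
    min_le_left _ _
  have h2 : 0 ≤ min (w.delay q) ((stateSeq x I 0).paid q) :=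
    le_min (w.delay_nonneg q) (State.paid_nonneg _ q)
  linarith

lemma le_delayShare_term {k : ℕ} {τ : ℝ} {q : Request M} (hk : k < numServices x I)
    (he : (stateSeq x I k).Eligible (svcTime x I k) (svc x I k).level q)
    (hτ : τ ≤ (svc x I k).horizon) (hq : q.accrued τ ≤ w.delay q) :
    q.accrued τ - (stateSeq x I k).paid q ≤
      min (w.delay q) ((stateSeq x I (k + 1)).paid q) -
        min (w.delay q) ((stateSeq x I k).paid q) := by
  rw [stateSeq_succ hk, State.paid_next_of_eligible he]
  have h1 := q.accrued_mono hτ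
  have h2 : q.accrued τ ≤ min (w.delay q) (max ((stateSeq x I k).paid q)
      (q.accrued (svc x I k).horizon)) := le_min hq (h1.trans (le_max_right _ _))
  have h3 : min (w.delay q) ((stateSeq x I k).paid q) ≤ (stateSeq x I k).paid q :=
    min_le_right _ _
  linarith

variable [Fintype M]

open Classical in
/-- The moves that are charged for the requests with property `E` around `z` on scale `ρ`: those
that are made after the first release of these requests and up to time `τ`, start close to `z`, and are
not much shorter than `ρ / n`. -/
noncomputable def charged (E : Request M → Prop) (τ : ℝ) (z : M) (R ρ : ℝ) : Finset ℕ :=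
  (Finset.range w.len).filter fun j => (∃ q, E q ∧ q.release ≤ w.s j) ∧ w.s j ≤ τ ∧
    dist z (w.u j) ≤ (R + 1) * ρ ∧ ρ ≤ 96 * Fintype.card M * w.d j

lemma mem_charged {E : Request M → Prop} {τ : ℝ} {z : M} {R ρ : ℝ} {j : ℕ} :
    j ∈ w.charged E τ z R ρ ↔ j < w.len ∧ (∃ q, E q ∧ q.release ≤ w.s j) ∧ w.s j ≤ τ ∧
      dist z (w.u j) ≤ (R + 1) * ρ ∧ ρ ≤ 96 * Fintype.card M * w.d j := by
  classical
  simp [charged]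

/-- The charge: the total length of the charged moves, each truncated at `ρ`. -/
noncomputable def charge (E : Request M → Prop) (τ : ℝ) (z : M) (R ρ : ℝ) : ℝ :=
  ∑ j ∈ w.charged E τ z R ρ, min (w.d j) ρ

lemma charge_nonneg (E : Request M → Prop) (τ : ℝ) (z : M) (R : ℝ) {ρ : ℝ} (hρ : 0 ≤ ρ) :
    0 ≤ w.charge E τ z R ρ := Finset.sum_nonneg fun _ _ => le_min dist_nonneg hρ

/-- If the charge is small, then the part of the walk from a visit to a request with property `E` up
to time `τ` is short. -/
lemma exists_tour_of_charge_lt {E : Request M → Prop} {τ : ℝ} {z : M} {R ρ : ℝ} (hρ : 0 < ρ)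
    (hlt : w.charge E τ z R ρ < ρ / 96) {q : Request M} (hE : E q) {a b : ℕ} (hab : a ≤ b)
    (hb : b ≤ w.len) (ha : w.u a = q.loc) (hz : dist z q.loc ≤ R * ρ)
    (hrel : ∀ j, a ≤ j → j < w.len → q.release ≤ w.s j) (hτ : ∀ j < b, w.s j ≤ τ) :
    (∀ i, a ≤ i → i ≤ b → dist q.loc (w.u i) ≤ ρ / 48) ∧
    ∃ l : List M, (∀ i, a ≤ i → i ≤ b → w.u i ∈ l) ∧
      tourLen z l ≤ 2 * dist z q.loc + ρ / 24 := by
  have := OnlineService.exists_tour_of_charge_lt z w.u hab hρ (R := R) (by rwa [ha])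
    (w.charged E τ z R ρ) (fun j h1 h2 h3 h4 =>
      w.mem_charged.2 ⟨by omega, ⟨q, hE, hrel j h1 (by omega)⟩, hτ j h2, h3, h4⟩) hlt
  rwa [ha] at this

end Offline

end OnlineService

namespace OnlineService

variable {M : Type*} [MetricSpace M]

namespace Offline

variable {x : M} {I : List (Request M)} (w : Offline x I)

/-! ### The distance between the servers -/

/-- The decrease of the distance between the servers in service `k`, if the server of the schedule
has made `κ` moves. -/
noncomputable def drop (k κ : ℕ) : ℝ :=
  dist (stateSeq x I k).loc (w.u κ) - dist (stateSeq x I (k + 1)).loc (w.u κ)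

lemma drop_ge {k : ℕ} (hk : k < numServices x I) (κ : ℕ) :
    -(3 * 8 ^ (svc x I k).level) ≤ w.drop k κ := by
  unfold drop
  rw [loc_stateSeq_succ hk]
  have h1 := (svc_valid hk).dist_target_le
  have h2 := dist_triangle_left (svc x I k).target (w.u κ) (stateSeq x I k).loc
  linarith

/-- The potential argument: the distance between the servers only increases by moves of the
schedule. -/
lemma sum_drop_le {κ : ℕ → ℕ} (hκ : ∀ k < numServices x I, κ k ≤ w.len)
    (hmono : ∀ k k', k ≤ k' → k' < numServices x I → κ k ≤ κ k') :
    ∑ k ∈ Finset.range (numServices x I), w.drop k (κ k) ≤ ∑ j ∈ Finset.range w.len, w.d j := by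
  -- `K n` counts the moves of the schedule made up to the time of the service before service `n`.
  let K : ℕ → ℕ := fun k => Nat.casesOn k 0 κ
  have key : ∀ n ≤ numServices x I, ∑ k ∈ Finset.range n, w.drop k (κ k) ≤
      ∑ j ∈ Finset.range (K n), w.d j - dist (stateSeq x I n).loc (w.u (K n)) := by
    intro n
    induction n with
    | zero =>
      intro _
      have : dist (stateSeq x I 0).loc (w.u 0) = 0 := by rw [w.u_zero]; exact dist_self x
      simp [K, this]
    | succ n ih =>
      intro hn
      have h1 := ih (by omega)
      have hK : K n ≤ κ n := by
        cases n with
        | zero => exact Nat.zero_le _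
        | succ n => exact hmono n (n + 1) (Nat.le_succ n) hn
      have h2 := dist_le_Ico_sum_dist w.u hK
      have h3 := Finset.sum_range_add_sum_Ico (fun j => w.d j) hK
      have h4 := dist_triangle (stateSeq x I n).loc (w.u (K n)) (w.u (κ n))
      change ∑ k ∈ Finset.range (n + 1), w.drop k (κ k) ≤
        ∑ j ∈ Finset.range (κ n), w.d j - dist (stateSeq x I (n + 1)).loc (w.u (κ n))
      rw [Finset.sum_range_succ, drop]
      unfold d at h1 h3 ⊢
      linarith
  have h1 := key _ le_rfl
  have h2 : K (numServices x I) ≤ w.len := by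
    cases h : numServices x I with
    | zero => exact Nat.zero_le _
    | succ n => exact hκ n (by omega)
  have h3 : ∑ j ∈ Finset.range (K (numServices x I)), w.d j ≤ ∑ j ∈ Finset.range w.len, w.d j :=
    Finset.sum_le_sum_of_subset_of_nonneg (Finset.range_subset_range.2 h2)
      fun _ _ _ => dist_nonneg
  linarith [dist_nonneg (x := (stateSeq x I (numServices x I)).loc)
    (y := w.u (K (numServices x I)))]

/-! ### Charges for local services -/

lemma penalty_le_delayShare {i : ℕ} (hi : i < numServices x I) (l : List M)
    (h : ∀ q ∈ I, (stateSeq x I i).Eligible (svcTime x I i) (svc x I i).level q → q.loc ∉ l →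
      q.accrued (svc x I i).horizon ≤ w.delay q) :
    penalty I ((stateSeq x I i).Eligible (svcTime x I i) (svc x I i).level)
      ((stateSeq x I i).paidBy (svcTime x I i)) (svc x I i).horizon l ≤ w.delayShare i := by
  refine reqSum_le_reqSum fun q hq => ?_
  have hnn := delayShare_term_nonneg (w := w) hi q
  by_cases hc : (stateSeq x I i).Eligible (svcTime x I i) (svc x I i).level q ∧ q.loc ∉ l
  · rw [if_pos hc]
    have h1 := w.le_delayShare_term hi hc.1 le_rfl (h q hq hc.1 hc.2)
    have h2 : (stateSeq x I i).paid q ≤ (stateSeq x I i).paidBy (svcTime x I i) q :=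
      le_max_left _ _
    exact max_le hnn (by linarith)
  · rw [if_neg hc]
    exact hnn

variable [Fintype M]

/-- The charge for a local service with origin `i`. -/
noncomputable def localCharge (i : ℕ) : ℝ :=
  w.charge (fun q => q ∈ I ∧ (stateSeq x I i).Eligible (svcTime x I i) (svc x I i).level q)
    (svc x I i).horizon (stateSeq x I i).loc 8 (8 ^ (svc x I i).level)

/-- A schedule must pay for what a prize-collecting tour could not avoid: if it moves little, then
there is a cheap tour of the requests that it visits up to the horizon, so it pays much delay. -/
lemma pow_le_of_isOrigin {k i : ℕ} {q : Request M} (hk : k < numServices x I)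
    (h : IsOrigin x I k i q) :
    (8 : ℝ) ^ (svc x I k).level ≤ 8 * w.delayShare i + 768 * w.localCharge i := by
  classical
  have hi : i < numServices x I := h.lt.trans hk
  set ρ : ℝ := 8 ^ (svc x I i).level with hρdef
  have hρ : 0 < ρ := by positivity
  rw [h.pow_eq, ← hρdef]
  have hQ := w.delayShare_nonneg hi
  by_cases hlt : w.localCharge i < ρ / 96
  swap
  · linarith
  have hC : 0 ≤ w.localCharge i := w.charge_nonneg _ _ _ _ hρ.le
  suffices hs : ρ ≤ w.delayShare i by linarith
  have hlow : ∀ l, 18 * ρ ≤ tourLen (stateSeq x I i).loc l +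
      penalty I ((stateSeq x I i).Eligible (svcTime x I i) (svc x I i).level)
        ((stateSeq x I i).paidBy (svcTime x I i)) (svc x I i).horizon l :=
    (svc_valid hi).le_cost.resolve_left fun hall => h.not_served (hall q h.mem h.eligible)
  -- The indices at which the walk visits a request whose delay it does not pay.
  let V : ℕ → Prop := fun a => a ≤ w.len ∧ (∀ j < a, w.s j ≤ (svc x I i).horizon) ∧
    ∃ q ∈ I, (stateSeq x I i).Eligible (svcTime x I i) (svc x I i).level q ∧ w.u a = q.loc ∧
      ∀ j, a ≤ j → j < w.len → q.release ≤ w.s j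
  have hV : ∀ q ∈ I, (stateSeq x I i).Eligible (svcTime x I i) (svc x I i).level q →
      w.delay q < q.accrued (svc x I i).horizon → ∃ a, V a ∧ w.u a = q.loc := by
    intro q hq he hlt
    obtain ⟨a, ha, hloc, h1, h2⟩ := w.exists_visit q hq _ hlt
    exact ⟨a, ⟨ha, h1, q, hq, he, hloc, h2⟩, hloc⟩
  by_cases hex : ∃ a, V a
  · -- The part of the walk from the first to the last of these visits.
    obtain ⟨-, -, q₀, hq₀, he₀, hloc₀, hrel₀⟩ := Nat.find_spec hex
    obtain ⟨b₀, hb₀⟩ := hex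
    have hmax := Nat.findGreatest_spec (P := V) hb₀.1 hb₀
    set a := Nat.find ⟨b₀, hb₀⟩ with ha
    set b := Nat.findGreatest V w.len with hb
    have hmem : ∀ c, V c → a ≤ c ∧ c ≤ b := fun c hc =>
      ⟨Nat.find_min' _ hc, Nat.le_findGreatest hc.1 hc⟩
    have hd := he₀.2.2.2
    obtain ⟨-, l, hl, hlen⟩ := w.exists_tour_of_charge_lt hρ hlt (q := q₀) ⟨hq₀, he₀⟩
      ((hmem b hmax).1) hmax.1 hloc₀ hd hrel₀ hmax.2.1
    have h1 := w.penalty_le_delayShare hi l fun q hq he hql => by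
      by_contra! hcon
      obtain ⟨c, hc, hloc⟩ := hV q hq he hcon
      exact hql (hloc ▸ hl c (hmem c hc).1 (hmem c hc).2)
    have h2 := hlow l
    linarith
  · have h1 := w.penalty_le_delayShare hi [] fun q hq he _ => by
      by_contra! hcon
      obtain ⟨c, hc, -⟩ := hV q hq he hcon
      exact hex ⟨c, hc⟩
    have h2 := hlow []
    have h3 : tourLen (stateSeq x I i).loc [] = 0 := by simp [tourLen, pathLen]
    linarith

/-! ### Charges for services that are not local -/

/-- The charge for a service that is not local. -/
noncomputable def farCharge (k : ℕ) : ℝ :=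
  w.charge ((stateSeq x I k).Far (svcTime x I k) (svc x I k).level) (svcTime x I k)
    (stateSeq x I k).loc 2 (8 ^ (svc x I k).level)

/-- If a schedule neither moves much nor pays much delay, then its server is close to most of the
far requests, and so the server of the algorithm gets closer to it. -/
lemma pow_le_of_not_local {k κ : ℕ} (hk : k < numServices x I) (hloc : ¬ LocalSvc x I k)
    (hκ : κ ≤ w.len) (hκs : ∀ j < w.len, (j < κ ↔ w.s j ≤ svcTime x I k)) :
    (8 : ℝ) ^ (svc x I k).level ≤
      16 * w.drop k κ + 784 * w.delayShare k + 4704 * w.farCharge k := by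
  classical
  set r : ℝ := 8 ^ (svc x I k).level with hrdef
  have hr : 0 < r := by positivity
  have hv := svc_valid hk
  have hQ := w.delayShare_nonneg hk
  have hC : 0 ≤ w.farCharge k := w.charge_nonneg _ _ _ _ hr.le
  have hdrop := w.drop_ge hk κ
  rw [← hrdef] at hdrop
  -- The coefficients are `49 * 16` and `49 * 96`, where `49 = 1 + 16 * 3` makes up for a possible
  -- increase of the distance between the servers by `3 * r`.
  by_cases hlt : w.farCharge k < r / 96
  swap
  · linarith
  by_cases hQlt : w.delayShare k < r / 16
  swap
  · linarith
  obtain ⟨hfar, -, hheavy⟩ := hv.kind.resolve_left hloc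
  rw [← hrdef] at hfar
  set μ := (stateSeq x I k).farLoad I (svcTime x I k) (svc x I k).level Set.univ with hμ
  -- The server of the schedule is close to all far requests whose delay it does not pay.
  have hnear : ∀ q ∈ I, (stateSeq x I k).Far (svcTime x I k) (svc x I k).level q →
      w.delay q < q.accrued (svcTime x I k) → q.loc ∈ Metric.closedBall (w.u κ) (r / 48) := by
    intro q hq hF hcon
    obtain ⟨a, ha, hqa, h1, h2⟩ := w.exists_visit q hq _ hcon
    have haκ : a ≤ κ := by
      by_contra! hlt
      exact absurd ((hκs κ (by omega)).2 (h1 κ hlt)) (lt_irrefl _)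
    have := (w.exists_tour_of_charge_lt hr hlt hF haκ hκ hqa hF.2.2.2.2 h2
      fun j hj => (hκs j (by omega)).1 hj).1 κ haκ le_rfl
    exact Metric.mem_closedBall.2 this
  have hsplit : μ ≤ (stateSeq x I k).farLoad I (svcTime x I k) (svc x I k).level
      (Metric.closedBall (w.u κ) (r / 48)) + w.delayShare k := by
    rw [hμ]
    unfold State.farLoad delayShare
    rw [← reqSum_add]
    refine reqSum_le_reqSum fun q hq => ?_
    have hnn := delayShare_term_nonneg (w := w) hk q
    have hres := (stateSeq x I k).resid_nonneg q (svcTime x I k)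
    by_cases hF : (stateSeq x I k).Far (svcTime x I k) (svc x I k).level q
    · rw [if_pos ⟨hF, Set.mem_univ _⟩]
      by_cases hcon : w.delay q < q.accrued (svcTime x I k)
      · rw [if_pos ⟨hF, hnear q hq hF hcon⟩]
        linarith
      · have he : (stateSeq x I k).Eligible (svcTime x I k) (svc x I k).level q :=
          ⟨hF.1, hF.2.1, hF.2.2.1.le, by linarith [hF.2.2.2.2]⟩
        have h1 := w.le_delayShare_term hk he hv.le_horizon (not_lt.1 hcon)
        have h2 : (stateSeq x I k).resid q (svcTime x I k) ≤ _ := max_le hnn h1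
        split_ifs <;> linarith
    · rw [if_neg fun h => hF h.1]
      split_ifs <;> linarith
  have hheavy₁ : (stateSeq x I k).Heavy I (svcTime x I k) (svc x I k).level (w.u κ) := by
    unfold State.Heavy
    rw [← hrdef]
    linarith
  have hheavy₂ := hheavy _ hheavy₁
  -- Two heavy points share a far request.
  obtain ⟨q, hF, hq₁, hq₂⟩ : ∃ q, (stateSeq x I k).Far (svcTime x I k) (svc x I k).level q ∧
      q.loc ∈ Metric.closedBall (w.u κ) (r / 48) ∧
      q.loc ∈ Metric.closedBall (svc x I k).target (r / 48) := by
    by_contra! hcon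
    have : (stateSeq x I k).farLoad I (svcTime x I k) (svc x I k).level
          (Metric.closedBall (w.u κ) (r / 48)) +
        (stateSeq x I k).farLoad I (svcTime x I k) (svc x I k).level
          (Metric.closedBall (svc x I k).target (r / 48)) ≤ μ := by
      rw [hμ]
      unfold State.farLoad
      rw [← reqSum_add]
      refine reqSum_le_reqSum fun q _ => ?_
      have hres := (stateSeq x I k).resid_nonneg q (svcTime x I k)
      by_cases hF : (stateSeq x I k).Far (svcTime x I k) (svc x I k).level q
      · have := hcon q hF
        by_cases h1 : q.loc ∈ Metric.closedBall (w.u κ) (r / 48)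
        · simp [hF, h1, this h1]
        · by_cases h2 : q.loc ∈ Metric.closedBall (svc x I k).target (r / 48)
          · simp [hF, h1, h2]
          · simp [hF, h1, h2, hres]
      · simp [hF]
    unfold State.Heavy at hheavy₁ hheavy₂
    rw [← hrdef] at hheavy₁ hheavy₂
    linarith
  have h1 := Metric.mem_closedBall.1 hq₁
  have h2 := Metric.mem_closedBall.1 hq₂
  have h3 := hF.2.2.2.1
  rw [← hrdef] at h3
  have h4 : r / 16 ≤ w.drop k κ := by
    unfold drop
    rw [loc_stateSeq_succ hk]
    have t1 := dist_triangle (stateSeq x I k).loc (w.u κ) q.loc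
    have t2 := dist_triangle_left (svc x I k).target (w.u κ) q.loc
    rw [dist_comm (w.u κ) q.loc] at t1
    linarith
  linarith

/-! ### Summing up -/

lemma sum_charge_le [Nonempty M] (T : Finset ℕ) (lev : ℕ → ℤ) (E : ℕ → Request M → Prop)
    (τ : ℕ → ℝ) (z : ℕ → M) (R : ℝ)
    (hdis : ∀ c ∈ T, ∀ c' ∈ T, c < c' → lev c = lev c' →
      dist (z c) (z c') ≤ 2 * (R + 1) * 8 ^ lev c → ∀ q, E c' q → τ c < q.release) :
    ∑ c ∈ T, w.charge (E c) (τ c) (z c) R (8 ^ lev c) ≤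
      (8 + Real.log (Fintype.card M)) * ∑ j ∈ Finset.range w.len, w.d j := by
  have hn : (1 : ℝ) ≤ Fintype.card M := by exact_mod_cast Fintype.card_pos
  have hdis' : ∀ c ∈ T, ∀ c' ∈ T, c < c' → lev c = lev c' →
      ∀ j ∈ w.charged (E c) (τ c) (z c) R (8 ^ lev c),
      j ∉ w.charged (E c') (τ c') (z c') R (8 ^ lev c') := by
    intro c hc c' hc' hlt hlev j hj hj'
    obtain ⟨-, -, h1, h2, -⟩ := w.mem_charged.1 hj
    obtain ⟨-, ⟨q, hq, hrel⟩, -, h3, -⟩ := w.mem_charged.1 hj'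
    rw [← hlev] at h3
    have := hdis c hc c' hc' hlt hlev
      (by linarith [dist_triangle_right (z c) (z c') (w.u j)]) q hq
    linarith
  have h1 := sum_charges_le T lev (fun c => w.charged (E c) (τ c) (z c) R (8 ^ lev c)) w.len w.d
    (X := 96 * Fintype.card M) (by linarith)
    (fun c _ j hj => ⟨(w.mem_charged.1 hj).1, (w.mem_charged.1 hj).2.2.2.2⟩)
    (fun c hc c' hc' j hj hj' hlev => by
      rcases lt_trichotomy c c' with h | h | h
      · exact absurd hj' (hdis' c hc c' hc' h hlev j hj)
      · exact h
      · exact absurd hj (hdis' c' hc' c hc h hlev.symm j hj'))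
  have hlog : Real.log (96 * Fintype.card M) ≤ 5 + Real.log (Fintype.card M) := by
    rw [Real.log_mul (by norm_num) (by linarith)]
    have : Real.log 96 ≤ 5 := by
      rw [Real.log_le_iff_le_exp (by norm_num)]
      have h5 : Real.exp 5 = Real.exp 1 ^ 5 := by rw [← Real.exp_nat_mul]; norm_num
      rw [h5]
      have := Real.exp_one_gt_d9
      calc (96 : ℝ) ≤ 2.7 ^ 5 := by norm_num
        _ ≤ _ := by gcongr; linarith
    linarith
  have h2 : ∑ j ∈ Finset.range w.len with 0 < w.d j, w.d j ≤ ∑ j ∈ Finset.range w.len, w.d j :=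
    Finset.sum_le_sum_of_subset_of_nonneg (Finset.filter_subset _ _) fun _ _ _ => dist_nonneg
  have h3 : 0 ≤ ∑ j ∈ Finset.range w.len with 0 < w.d j, w.d j :=
    Finset.sum_nonneg fun _ _ => dist_nonneg
  have hlogn := Real.log_nonneg hn
  calc _ ≤ _ := h1
    _ ≤ (8 + Real.log (Fintype.card M)) * ∑ j ∈ Finset.range w.len with 0 < w.d j, w.d j := by
      exact mul_le_mul_of_nonneg_right (by linarith) h3
    _ ≤ _ := by gcongr

end Offline

end OnlineService

namespace OnlineService

variable {M : Type*} [MetricSpace M]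

/-! ### Competitiveness -/

namespace Offline

variable {x : M} {I : List (Request M)}

/-- The scales of the services of the algorithm, compared with the cost of a schedule. -/
lemma sum_pow_le [Fintype M] (w : Offline x I) :
    ∑ k ∈ Finset.range (numServices x I), (8 : ℝ) ^ (svc x I k).level ≤
      50000 * (1 + Real.log (Fintype.card M)) *
        (∑ j ∈ Finset.range w.len, w.d j + reqSum I w.delay) := by
  classical
  have : Nonempty M := ⟨x⟩
  set N := numServices x I with hN
  set L := ∑ j ∈ Finset.range w.len, w.d j with hL
  set D := reqSum I w.delay with hD
  have hL0 : 0 ≤ L := Finset.sum_nonneg fun _ _ => dist_nonneg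
  have hD0 : 0 ≤ D := reqSum_nonneg fun q _ => w.delay_nonneg q
  have hn : (1 : ℝ) ≤ Fintype.card M := by exact_mod_cast Fintype.card_pos
  have hlog := Real.log_nonneg hn
  choose κ hκ hκs using fun t => exists_moves_count w.s w.len w.s_mono t
  have hκmono : ∀ t t', t ≤ t' → κ t ≤ κ t' := by
    intro t t' h
    by_contra! hlt
    have h1 := hκ t
    have h2 := (hκs t (κ t') (by omega)).1 hlt
    exact absurd ((hκs t' (κ t') (by omega)).2 (h2.trans h)) (lt_irrefl _)
  have hdrop := w.sum_drop_le (κ := fun k => κ (svcTime x I k)) (fun k _ => hκ _)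
    fun k k' hkk hk' => hκmono _ _ (by
      rcases hkk.eq_or_lt with rfl | h
      · exact le_rfl
      · exact (svcTime_lt_svcTime h hk').le)
  rw [← hN, ← hL] at hdrop
  set A := (Finset.range N).filter fun k => LocalSvc x I k with hA
  set P := (Finset.range N).filter fun k => ¬ LocalSvc x I k with hP
  have hAmem : ∀ k ∈ A, k < N ∧ LocalSvc x I k := fun k hk =>
    ⟨Finset.mem_range.1 (Finset.mem_filter.1 hk).1, (Finset.mem_filter.1 hk).2⟩
  have hPmem : ∀ k ∈ P, k < N ∧ ¬ LocalSvc x I k := fun k hk =>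
    ⟨Finset.mem_range.1 (Finset.mem_filter.1 hk).1, (Finset.mem_filter.1 hk).2⟩
  have horig : ∀ k, ∃ i, k ∈ A → ∃ q, IsOrigin x I k i q := by
    intro k
    by_cases hk : k ∈ A
    · obtain ⟨i, hi⟩ := (hAmem k hk).2.exists_isOrigin (hAmem k hk).1
      exact ⟨i, fun _ => hi⟩
    · exact ⟨0, fun h => absurd h hk⟩
  choose π hπ using horig
  -- The services that are local.
  have hA1 : ∑ k ∈ A, (8 : ℝ) ^ (svc x I k).level ≤
      8 * ∑ k ∈ A, w.delayShare (π k) + 768 * ∑ k ∈ A, w.localCharge (π k) := by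
    rw [Finset.mul_sum, Finset.mul_sum, ← Finset.sum_add_distrib]
    refine Finset.sum_le_sum fun k hk => ?_
    obtain ⟨q, hq⟩ := hπ k hk
    exact w.pow_le_of_isOrigin (hAmem k hk).1 hq
  have hA2 : ∑ k ∈ A, w.delayShare (π k) ≤ D := by
    have hinj : Set.InjOn π A := by
      intro k hk k' hk' h
      obtain ⟨q, hq⟩ := hπ k hk
      obtain ⟨q', hq'⟩ := hπ k' hk'
      rw [← h] at hq'
      exact hq.injective hq' (hAmem k hk).1 (hAmem k' hk').1
    rw [← Finset.sum_image (f := w.delayShare) hinj]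
    refine (Finset.sum_le_sum_of_subset_of_nonneg (fun i hi => ?_) fun i hi _ =>
      w.delayShare_nonneg (Finset.mem_range.1 hi)).trans w.sum_delayShare_le
    obtain ⟨k, hk, rfl⟩ := Finset.mem_image.1 hi
    obtain ⟨q, hq⟩ := hπ k hk
    exact Finset.mem_range.2 (hq.lt.trans (hAmem k hk).1)
  have hA3 : ∑ k ∈ A, w.localCharge (π k) ≤ (8 + Real.log (Fintype.card M)) * L := by
    refine w.sum_charge_le A (fun k => (svc x I (π k)).level) _ _ _ 8 ?_
    intro k hk k' hk' hlt hlev hd q hq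
    obtain ⟨q₁, h₁⟩ := hπ k hk
    obtain ⟨q₂, h₂⟩ := hπ k' hk'
    exact h₁.horizon_lt.trans
      (h₁.svcTime_lt_release h₂ hlt (hAmem k' hk').1 hlev (by linarith) hq.2)
  -- The other services.
  have hP1 : ∑ k ∈ P, (8 : ℝ) ^ (svc x I k).level ≤
      16 * ∑ k ∈ P, w.drop k (κ (svcTime x I k)) + 784 * ∑ k ∈ P, w.delayShare k +
        4704 * ∑ k ∈ P, w.farCharge k := by
    rw [Finset.mul_sum, Finset.mul_sum, Finset.mul_sum, ← Finset.sum_add_distrib,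
      ← Finset.sum_add_distrib]
    refine Finset.sum_le_sum fun k hk => ?_
    exact w.pow_le_of_not_local (hPmem k hk).1 (hPmem k hk).2 (hκ _) (hκs _)
  have hP2 : ∑ k ∈ P, w.delayShare k ≤ D :=
    (Finset.sum_le_sum_of_subset_of_nonneg (Finset.filter_subset _ _) fun i hi _ =>
      w.delayShare_nonneg (Finset.mem_range.1 hi)).trans w.sum_delayShare_le
  have hP3 : ∑ k ∈ P, w.farCharge k ≤ (8 + Real.log (Fintype.card M)) * L := by
    refine w.sum_charge_le P (fun k => (svc x I k).level) _ _ _ 2 ?_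
    intro k hk k' hk' hlt hlev hd q hq
    by_contra! hrel
    have h1 : (stateSeq x I k').lvl q ≤ ((svc x I k).level : WithBot ℤ) := by
      rw [show (svc x I k).level = (svc x I k').level from hlev]
      exact hq.2.2.1.le
    have h2 := lt_dist_of_active hlt (hPmem k' hk').1 hrel hq.2.1 h1
    have h3 := hq.2.2.2.2
    rw [show (svc x I k').level = (svc x I k).level from hlev.symm] at h3
    linarith [dist_triangle (stateSeq x I k).loc (stateSeq x I k').loc q.loc]
  have hP4 : ∑ k ∈ P, w.drop k (κ (svcTime x I k)) ≤ L := by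
    refine le_trans (le_of_eq ?_) hdrop
    refine Finset.sum_subset (Finset.filter_subset _ _) fun k hk hkP => ?_
    have hk' := Finset.mem_range.1 hk
    have hloc : LocalSvc x I k := by
      by_contra hn
      exact hkP (Finset.mem_filter.2 ⟨hk, hn⟩)
    rw [drop, loc_stateSeq_succ hk', hloc.2, sub_self]
  have hsum : ∑ k ∈ Finset.range N, (8 : ℝ) ^ (svc x I k).level =
      ∑ k ∈ A, (8 : ℝ) ^ (svc x I k).level + ∑ k ∈ P, (8 : ℝ) ^ (svc x I k).level :=
    (Finset.sum_filter_add_sum_filter_not _ _ _).symm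
  rw [hsum]
  nlinarith [mul_nonneg hlog hL0, mul_nonneg hlog hD0]

end Offline

/-- A schedule of finite cost, as a walk. -/
lemma exists_offline {x : M} {I : List (Request M)} {S : Schedule M} (h : cost x I S ≠ ⊤) :
    ∃ w : Offline x I, cost x I S =
      ENNReal.ofReal (∑ j ∈ Finset.range w.len, w.d j + reqSum I w.delay) := by
  obtain ⟨u, s, hu, hs, -, hcost, hat⟩ := exists_walk x S.moves S.sorted
  have hsum : (I.map (delayCost x S)).sum ≠ ⊤ := (ENNReal.add_ne_top.1 h).2
  have hfin : ∀ q ∈ I, delayCost x S q ≠ ⊤ := fun q hq =>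
    ne_top_of_le_ne_top hsum (List.single_le_sum (fun _ _ => zero_le) _ (List.mem_map_of_mem hq))
  refine ⟨⟨S.moves.length, u, s, fun q => (delayCost x S q).toReal, hu, hs,
    fun q => ENNReal.toReal_nonneg, fun q hq τ hlt => ?_⟩, ?_⟩
  · rw [← ENNReal.lt_ofReal_iff_toReal_lt (hfin q hq), delayCost] at hlt
    obtain ⟨t, hlt⟩ := iInf_lt_iff.1 hlt
    obtain ⟨⟨hrel, hq⟩, hlt⟩ := iInf_lt_iff.1 hlt
    have htτ : t ≤ τ := by
      by_contra! hcon
      rw [← q.accrued_of_release_le hrel] at hlt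
      exact not_le.2 hlt (ENNReal.ofReal_le_ofReal (q.accrued_mono hcon.le))
    obtain ⟨a, ha, hloc, h1, h2⟩ := hat q.loc t hq
    exact ⟨a, ha, hloc, fun j hj => (h1 j hj).trans htτ, fun j hj hj' => hrel.trans (h2 j hj hj')⟩
  · have hreq : ∀ J : List (Request M), (∀ q ∈ J, delayCost x S q ≠ ⊤) →
        (J.map (delayCost x S)).sum =
          ENNReal.ofReal (reqSum J fun q => (delayCost x S q).toReal) := by
      intro J hJ
      induction J with
      | nil => simp [reqSum]
      | cons q J ih =>
        have h1 := ih fun q hq => hJ q (List.mem_cons_of_mem _ hq)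
        have h2 : (reqSum (q :: J) fun q => (delayCost x S q).toReal) =
          (delayCost x S q).toReal + reqSum J fun q => (delayCost x S q).toReal := by simp [reqSum]
        rw [List.map_cons, List.sum_cons, h2, ENNReal.ofReal_add ENNReal.toReal_nonneg
          (reqSum_nonneg fun _ _ => ENNReal.toReal_nonneg), h1,
          ENNReal.ofReal_toReal (hJ q (by simp))]
    change cost x I S = ENNReal.ofReal (∑ j ∈ Finset.range S.moves.length,
      dist (u j) (u (j + 1)) + reqSum I fun q => (delayCost x S q).toReal)
    rw [ENNReal.ofReal_add (Finset.sum_nonneg fun _ _ => dist_nonneg)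
      (reqSum_nonneg fun _ _ => ENNReal.toReal_nonneg), ← hreq I hfin]
    unfold cost
    rw [hcost]

/-- The algorithm is `O(1 + log n)`-competitive. -/
lemma cost_algorithm_le_opt [Fintype M] (x : M) (I : List (Request M)) :
    cost x I ((algorithm M).run x I) ≤
      ENNReal.ofReal (57 * 50000 * (1 + Real.log (Fintype.card M))) * opt x I := by
  have : Nonempty M := ⟨x⟩
  have hn : (1 : ℝ) ≤ Fintype.card M := by exact_mod_cast Fintype.card_pos
  have hlog := Real.log_nonneg hn
  have hpos : (0 : ℝ) < 57 * 50000 * (1 + Real.log (Fintype.card M)) := by positivity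
  unfold opt
  rw [ENNReal.mul_iInf_of_ne (by simpa using hpos) ENNReal.ofReal_ne_top]
  refine le_iInf fun S => ?_
  by_cases hS : cost x I S = ⊤
  · rw [hS, ENNReal.mul_top (by simpa using hpos)]
    exact le_top
  · obtain ⟨w, hw⟩ := exists_offline hS
    rw [hw, ← ENNReal.ofReal_mul hpos.le]
    refine (cost_algorithm_le x I).trans (ENNReal.ofReal_le_ofReal ?_)
    linarith [w.sum_pow_le]

/-- On a space with one point nothing has to be paid. -/
lemma opt_eq_zero_of_subsingleton [Subsingleton M] (x : M) (I : List (Request M)) :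
    opt x I = 0 := by
  refine le_antisymm ((iInf_le _ ⟨[], List.Pairwise.nil⟩).trans (le_of_eq ?_)) zero_le
  have : ∀ q : Request M, delayCost x ⟨[], List.Pairwise.nil⟩ q = 0 := fun q => by
    refine le_antisymm ((iInf₂_le q.release ⟨le_rfl, Subsingleton.elim _ _⟩).trans ?_) zero_le
    rw [q.delay_release, ENNReal.ofReal_zero]
  simp [cost, moveCost, funext this]

end OnlineService

theorem theoremA1 :
    ∃ C : ℝ, 0 < C ∧ ∀ (M : Type*) [MetricSpace M] [Fintype M],
      ∃ A : OnlineService.OnlineAlgorithm M,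
        A.IsCompetitive (C * Real.log (Fintype.card M)) := by
  refine ⟨57 * 50000 * 3, by norm_num, fun M _ _ => ⟨OnlineService.algorithm M, fun x I => ?_⟩⟩
  have hle := OnlineService.cost_algorithm_le_opt x I
  rcases subsingleton_or_nontrivial M with hM | hM
  · rw [OnlineService.opt_eq_zero_of_subsingleton, mul_zero] at hle ⊢
    exact hle
  · refine hle.trans ?_
    gcongr ?_ * _
    refine ENNReal.ofReal_le_ofReal ?_
    have h2 : (2 : ℝ) ≤ Fintype.card M := by exact_mod_cast Fintype.one_lt_card
    have h3 := Real.log_le_log (by norm_num) h2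
    linarith [Real.log_two_gt_d9]
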